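/- Let $\mathbb K=\mathbb R$ or $\mathbb C$, let $m$ be Lebesgue measure on $[0,1]$, and let $\Lambda=(\lambda_n)_{n\ge1}$ be a strictly increasing sequence of positive real numbers with $\sum_{n\ge 1} 1/\lambda_n<\infty$. Let $M^1_\Lambda$ be the closed linear span of the functions $x^{\lambda_n}$ $(n\ge 1)$ in $L^1=L^1([0,1],m;\mathbb K)$. Each $f\in M^1_\Lambda$ is identified with its version that is continuous on $[0,1)$ (and continuous at $1$ as well whenever its limit at $1$ exists). A positive Borel measure $\mu$ on $[0,1]$ is called $\Lambda$-embedding if there is a constant $C>0$ such that $\|p\|_{L^1(\mu)}\le C\|p\|_{L^1}$ for every finite linear combination $p$ of the functions $x^{\lambda_n}$. Write $\iota_\mu: M^1_\Lambda\to L^1(\mu)$, $f\mapsto f$, for the embedding, and let $\|A\|_e=\inf\{\|A-K\|: K\text{ compact}\}$ be the essential norm of a bounded operator $A:X\to Y$, where $K$ runs over the compact operators $X\to Y$. Let $\phi:[0,1]\to[0,1]$ and $\psi:[0,1]\to\mathbb K$ be Borel functions, let $(\mathcal T_\psi\circ C_\phi) f=\psi\cdot(f\circ\phi)$, and let $\mu=\phi^*(|\psi|\,dm)$,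 that is, $\mu(E)=\int_{\phi^{-1}(E)}|\psi|\,dm$ for all Borel sets $E\subset[0,1]$ (so $\mu=\phi^*(\psi\,dm)$ if $\psi\ge0$). Then: (i) $\mathcal T_\psi\circ C_\phi$ is bounded from $M^1_\Lambda$ to $L^1$ if and only if $\mu$ is $\Lambda$-embedding, and also if and only if $\iota_\mu$ is a bounded operator from $M^1_\Lambda$ to $L^1(\mu)$. (ii) $\mathcal T_\psi\circ C_\phi$ is compact from $M^1_\Lambda$ to $L^1$ if and only if $\iota_\mu$ is compact from $M^1_\Lambda$ to $L^1(\mu)$. (iii) Suppose that $m(\phi^{-1}(\{1\}))=0$ and that $\mathcal T_\psi\circ C_\phi$ is bounded from $M^1_\Lambda$ to $L^1$. Let $\mu'_n=\mu_{|[1-\frac1n,1]}$. Then $\iota_\mu: M^1_\Lambda\to L^1(\mu)$ and $\iota_{\mu'_n}: M^1_\Lambda\to L^1(\mu'_n)$ are bounded, and $$\|\mathcal T_\psi\circ C_\phi\|_e=\|\iota_\mu\|_e=\lim_{n\to\infty}\|\iota_{\mu'_n}\|.$$ -/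

import Mathlib

open MeasureTheory Filter Topology Set
open scoped ENNReal NNReal unitInterval

noncomputable section

/-- The monomial `x ↦ x ^ a` on `[0,1]`, with values in `𝕜 = ℝ` or `ℂ`. -/
def muntzMonomial (𝕜 : Type*) [RCLike 𝕜] (a : ℝ) : I → 𝕜 :=
  fun x => (((x : ℝ) ^ a : ℝ) : 𝕜)

/-- The Müntz polynomials: finite linear combinations of the functions `x ^ (Λ n)`. -/
def muntzPolynomials (𝕜 : Type*) [RCLike 𝕜] (Λ : ℕ → ℝ) : Submodule 𝕜 (I → 𝕜) :=
  Submodule.span 𝕜 (Set.range fun n => muntzMonomial 𝕜 (Λ n))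

/-- The Müntz space `M¹_Λ`: the closed linear span in `L¹([0,1])` of the functions
`x ^ (Λ n)`. -/
def muntzSpace (𝕜 : Type*) [RCLike 𝕜] (Λ : ℕ → ℝ) :
    Submodule 𝕜 (Lp 𝕜 1 (volume : Measure I)) :=
  (Submodule.span 𝕜 {f : Lp 𝕜 1 (volume : Measure I) |
    ∃ n, (f : I → 𝕜) =ᵐ[volume] muntzMonomial 𝕜 (Λ n)}).topologicalClosure

/-- `g` is the version of the class `f` that is continuous on `[0,1)`, and that is continuous at
`1` as well whenever its limit at `1` exists. So `g` is determined by `f` on `[0,1)`, and on all of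
`[0,1]` if `f` is the class of a function that is continuous on `[0,1]`. -/
def IsContinuousVersion {𝕜 : Type*} [RCLike 𝕜] (f : Lp 𝕜 1 (volume : Measure I))
    (g : I → 𝕜) : Prop :=
  (f : I → 𝕜) =ᵐ[volume] g ∧ ContinuousOn g (Set.Iio 1) ∧
    ((∃ l : 𝕜, Tendsto g (𝓝[<] 1) (𝓝 l)) → ContinuousAt g 1)

open Classical in
/-- The element `f` of a Müntz space, read as a function on `[0,1]`: its version that is continuous
on `[0,1)`. (For classes without such a version, an arbitrary version.) -/
def muntzFun {𝕜 : Type*} [RCLike 𝕜] (f : Lp 𝕜 1 (volume : Measure I)) : I → 𝕜 :=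
  if h : ∃ g, IsContinuousVersion f g then h.choose else f

/-- A measure `μ` on `[0,1]` is `Λ`-embedding if `‖p‖_{L¹(μ)} ≤ C ‖p‖_{L¹(m)}` for all
Müntz polynomials `p`. -/
def IsMuntzEmbedding (𝕜 : Type*) [RCLike 𝕜] (Λ : ℕ → ℝ) (μ : Measure I) : Prop :=
  ∃ C : ℝ≥0, 0 < C ∧ ∀ p ∈ muntzPolynomials 𝕜 Λ,
    eLpNorm p 1 μ ≤ C * eLpNorm p 1 (volume : Measure I)

/-- The bounded operator `S` is the embedding `ι_μ : M¹_Λ → L¹(μ)`, `f ↦ f`. -/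
def IsEmbeddingOperator {𝕜 : Type*} [RCLike 𝕜] {Λ : ℕ → ℝ} (μ : Measure I)
    (S : muntzSpace 𝕜 Λ →L[𝕜] Lp 𝕜 1 μ) : Prop :=
  ∀ f : muntzSpace 𝕜 Λ,
    (S f : I → 𝕜) =ᵐ[μ] muntzFun (f : Lp 𝕜 1 (volume : Measure I))

/-- The bounded operator `T` is the weighted composition operator
`M¹_Λ → L¹([0,1])`, `f ↦ ψ · (f ∘ φ)`. -/
def IsWeightedCompOperator {𝕜 : Type*} [RCLike 𝕜] {Λ : ℕ → ℝ} (φ : I → I) (ψ : I → 𝕜)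
    (T : muntzSpace 𝕜 Λ →L[𝕜] Lp 𝕜 1 (volume : Measure I)) : Prop :=
  ∀ f : muntzSpace 𝕜 Λ, (T f : I → 𝕜) =ᵐ[volume]
    fun x => ψ x * muntzFun (f : Lp 𝕜 1 (volume : Measure I)) (φ x)

/-- The measure `E ↦ ∫_{φ⁻¹(E)} |ψ| dm` on `[0,1]`. -/
def weightedPullback {𝕜 : Type*} [RCLike 𝕜] (φ : I → I) (ψ : I → 𝕜) : Measure I :=
  Measure.map φ ((volume : Measure I).withDensity fun x => ‖ψ x‖ₑ)

/-- The restriction `μ'_n` of `μ` to `[1 - 1/n, 1]`. -/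
def tailMeasure (μ : Measure I) (n : ℕ) : Measure I :=
  μ.restrict {x : I | 1 - 1 / (n : ℝ) ≤ (x : ℝ)}

/-- The essential norm: the distance of a bounded operator to the compact operators. -/
def essentialNorm {𝕜 : Type*} [RCLike 𝕜] {X Y : Type*} [NormedAddCommGroup X] [NormedSpace 𝕜 X]
    [NormedAddCommGroup Y] [NormedSpace 𝕜 Y] (T : X →L[𝕜] Y) : ℝ :=
  ⨅ K : {K : X →L[𝕜] Y // IsCompactOperator K}, ‖T - K.1‖

end

/-! Since `μ` is the image under `φ` of `|ψ| dm`, the map `J : g ↦ ψ · (g ∘ φ)` is a linear isometry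
of `L¹(μ)` into `L¹`, and the weighted composition operator `T` is `J ∘ ι_μ`. Boundedness and
compactness pass between the two operators; compactness comes back through `J` because its range is
closed. What remains of (i) is to extend the embedding inequality from Müntz polynomials to `M¹_Λ`.
This is Fatou's lemma, once `μ {1} = 0` is known (`IsMuntzEmbedding.measure_singleton_one`).

For (iii) the essential norms are squeezed by the tails. Up to `ε`, `ι_μ` minus a finite rank
operator is controlled by its part on `[1 - 1/n, 1]`
(`IsEmbeddingOperator.exists_isCompactOperator_sub_le`), so `‖ι_μ‖_e ≤ ‖ι_{μ'_n}‖`. Conversely, a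
compact `K` into `L¹` maps the unit ball to a uniformly integrable set, and `m(φ⁻¹[1 - 1/n, 1]) →
0`, so `‖ι_{μ'_n}‖ ≤ ‖T - K‖ + ε` for large `n`. Composition with `J` gives `‖T‖_e ≤ ‖ι_μ‖_e`, which
closes the circle.

The analytic input is that `x^(-λ₀) f` is Hölder in the variable `x^β` on `(0, r]`, with constant
proportional to `‖f‖₁` (`exists_muntzPolynomials_holder_bound`). Dividing by `x^λ₀` is needed
because `μ` may have infinite mass near `0`. The Mellin transform on the imaginary axis turns `p = ∑
bₙ x^λₙ` into `∑ bₙ / (λₙ + 1 - iy)`, bounded by `‖p‖₁`. Phragmén–Lindelöf carries the bound into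
the right half-plane at the cost of an inverse Blaschke product, which grows subexponentially away
from the poles because `∑ 1/λₙ < ∞`. Cauchy's formula recovers the differences of `x^(-λ₀) p` from
this partial fraction; the kernel decays exponentially for `x, y ≤ r < 1`, so the bound is uniform
in the degree. -/

/-! ### Growth of partial fractions in the right half-plane -/

/-- A partial fraction with poles on the positive half-line that is bounded by `A` on the imaginary
axis is bounded in the right half-plane by `A` times an inverse Blaschke product. -/
theorem norm_sum_div_le_mul_prod {ι : Type*} (s : Finset ι) (μ : ι → ℝ) (hμ : ∀ i ∈ s, 0 < μ i)
    (b : ι → ℂ) {A : ℝ} (hA : ∀ y : ℝ, ‖∑ i ∈ s, b i / ((μ i : ℂ) - y * Complex.I)‖ ≤ A)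
    {z : ℂ} (hz : 0 < z.re) (hne : ∀ i ∈ s, z ≠ μ i) :
    ‖∑ i ∈ s, b i / ((μ i : ℂ) - z)‖ ≤ A * ∏ i ∈ s, ‖((μ i : ℂ) + z) / ((μ i : ℂ) - z)‖ := by
  classical
  -- The partial fraction times its Blaschke product, with each pole cancelled in the formula
  -- itself, so that `H` is holomorphic at the points `μ i` too.
  set H : ℂ → ℂ := fun z => ∑ i ∈ s, b i / ((μ i : ℂ) + z) *
    ∏ j ∈ s.erase i, (((μ j : ℂ) - z) / ((μ j : ℂ) + z)) with hH
  have hpos : ∀ i ∈ s, ∀ z : ℂ, 0 ≤ z.re → (μ i : ℂ) + z ≠ 0 := by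
    intro i hi z hz h
    have := congrArg Complex.re h
    simp at this
    linarith [hμ i hi]
  have hfac : ∀ i ∈ s, ∀ z : ℂ, 0 ≤ z.re → ‖((μ i : ℂ) - z) / ((μ i : ℂ) + z)‖ ≤ 1 := by
    intro i hi z hz
    rw [norm_div]
    apply div_le_one_of_le₀ _ (norm_nonneg _)
    rw [← sq_le_sq₀ (norm_nonneg _) (norm_nonneg _), ← Complex.normSq_eq_norm_sq,
      ← Complex.normSq_eq_norm_sq, Complex.normSq_apply, Complex.normSq_apply]
    simp
    nlinarith [hμ i hi]
  have hprod : ∀ i ∈ s, ∀ z : ℂ, 0 ≤ z.re →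
      ‖∏ j ∈ s.erase i, (((μ j : ℂ) - z) / ((μ j : ℂ) + z))‖ ≤ 1 := by
    intro i _ z hz
    rw [norm_prod]
    exact Finset.prod_le_one (fun _ _ => norm_nonneg _)
      fun j hj => hfac j (Finset.mem_of_mem_erase hj) z hz
  have hHeq : ∀ z : ℂ, (∀ i ∈ s, z ≠ μ i) →
      H z = (∑ i ∈ s, b i / ((μ i : ℂ) - z)) * ∏ j ∈ s, (((μ j : ℂ) - z) / ((μ j : ℂ) + z)) := by
    intro z hz
    rw [hH, Finset.sum_mul]
    refine Finset.sum_congr rfl fun i hi => ?_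
    rw [← Finset.mul_prod_erase s _ hi]
    have : (μ i : ℂ) - z ≠ 0 := sub_ne_zero.2 (hz i hi).symm
    rw [← mul_assoc]
    congr 1
    rw [div_mul_div_cancel₀ this]
  have hbound : ∀ z : ℂ, 0 ≤ z.re → ‖H z‖ ≤ ∑ i ∈ s, ‖b i‖ / ‖(μ i : ℂ) + z‖ := by
    intro z hz
    refine (norm_sum_le _ _).trans (Finset.sum_le_sum fun i hi => ?_)
    rw [norm_mul, norm_div]
    exact mul_le_of_le_one_right (by positivity) (hprod i hi z hz)
  have hdiff : ∀ z : ℂ, 0 ≤ z.re → DifferentiableAt ℂ H z := by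
    intro z hz
    refine DifferentiableAt.fun_sum fun i hi => ?_
    refine DifferentiableAt.mul (DifferentiableAt.div (by fun_prop) (by fun_prop)
      (hpos i hi z hz)) ?_
    refine DifferentiableAt.fun_finsetProd fun j hj => ?_
    exact DifferentiableAt.div (by fun_prop) (by fun_prop)
      (hpos j (Finset.mem_of_mem_erase hj) z hz)
  -- Phragmén–Lindelöf: `H` is bounded, tends to `0` along the positive axis, and is at most `A` on
  -- the imaginary axis, where the Blaschke factors do not exceed `1` in modulus.
  have key : ‖H z‖ ≤ A := by
    refine PhragmenLindelof.right_half_plane_of_tendsto_zero_on_real ?_ ?_ ?_ ?_ hz.le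
    · have hcl : closure {z : ℂ | 0 < z.re} = {z : ℂ | 0 ≤ z.re} := Complex.closure_setOfPred_lt_re 0
      refine ⟨fun z hz => (hdiff z (le_of_lt hz)).differentiableWithinAt, ?_⟩
      rw [hcl]
      exact fun z hz => (hdiff z hz).continuousAt.continuousWithinAt
    · refine ⟨1, by norm_num, 0, ?_⟩
      refine Asymptotics.IsBigO.of_bound (∑ i ∈ s, ‖b i‖ / μ i) ?_
      rw [eventually_inf_principal]
      refine Eventually.of_forall fun z hz => ?_
      simp only [zero_mul, Real.exp_zero, norm_one, mul_one]
      refine (hbound z (le_of_lt hz)).trans (Finset.sum_le_sum fun i hi => ?_)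
      refine div_le_div_of_nonneg_left (norm_nonneg _) (hμ i hi) ?_
      refine le_trans ?_ (Complex.re_le_norm _)
      simpa using le_of_lt hz
    · refine squeeze_zero_norm' (a := fun x : ℝ => ∑ i ∈ s, ‖b i‖ / x) ?_ ?_
      · filter_upwards [eventually_gt_atTop 0] with x hx
        refine (hbound x (by simpa using hx.le)).trans (Finset.sum_le_sum fun i hi => ?_)
        refine div_le_div_of_nonneg_left (norm_nonneg _) hx ?_
        refine le_trans ?_ (Complex.re_le_norm _)
        simpa using (hμ i hi).le
      · rw [← Finset.sum_const_zero (ι := ι) (s := s)]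
        exact tendsto_finsetSum _ fun i _ => tendsto_const_nhds.div_atTop tendsto_id
    · intro y
      rw [hHeq]
      · rw [norm_mul]
        refine (mul_le_of_le_one_right (norm_nonneg _) ?_).trans (hA y)
        rw [norm_prod]
        exact Finset.prod_le_one (fun _ _ => norm_nonneg _)
          fun j hj => hfac j hj _ (by simp)
      · intro i hi h
        have := congrArg Complex.re h
        simp at this
        linarith [hμ i hi]
  have hne' : ∀ i ∈ s, (μ i : ℂ) - z ≠ 0 := fun i hi => sub_ne_zero.2 (hne i hi).symm
  rw [hHeq z hne, norm_mul] at key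
  have hP : ∏ i ∈ s, ‖((μ i : ℂ) + z) / ((μ i : ℂ) - z)‖ =
      (‖∏ j ∈ s, (((μ j : ℂ) - z) / ((μ j : ℂ) + z))‖)⁻¹ := by
    rw [norm_prod, ← Finset.prod_inv_distrib]
    refine Finset.prod_congr rfl fun i _ => ?_
    rw [← norm_inv, inv_div]
  rw [hP, ← div_eq_mul_inv, le_div_iff₀]
  · exact key
  · rw [norm_pos_iff]
    exact Finset.prod_ne_zero_iff.2 fun i hi => div_ne_zero (hne' i hi) (hpos i hi z hz.le)

/-- If `|z² - μ²| ≥ κ μ²` then the factor `(μ + z) / (μ - z)` is at most `6 / κ`. -/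
theorem norm_add_div_sub_le {μ κ : ℝ} (hμ : 0 < μ) (hκ : 0 < κ) (hκ1 : κ ≤ 1) {z : ℂ}
    (h : κ * μ ^ 2 ≤ ‖(μ : ℂ) ^ 2 - z ^ 2‖) :
    ‖((μ : ℂ) + z) / ((μ : ℂ) - z)‖ ≤ 6 / κ := by
  have h0 : 0 < ‖(μ : ℂ) ^ 2 - z ^ 2‖ := lt_of_lt_of_le (by positivity) h
  have hz1 : ‖z‖ ^ 2 ≤ μ ^ 2 + ‖(μ : ℂ) ^ 2 - z ^ 2‖ := by
    have := norm_sub_le ((μ : ℂ) ^ 2) ((μ : ℂ) ^ 2 - z ^ 2)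
    simpa [abs_of_pos hμ] using this
  have hne : (μ : ℂ) + z ≠ 0 := by
    intro h'
    rw [sq_sub_sq, h', zero_mul, norm_zero] at h0
    exact lt_irrefl _ h0
  -- With `d = |μ² - z²|` the numerator is at most `2μ² + 2|z|² ≤ 4μ² + 2d ≤ (4/κ + 2) d`, whence
  -- the `6/κ`.
  have heq : ((μ : ℂ) + z) / ((μ : ℂ) - z) = ((μ : ℂ) + z) ^ 2 / ((μ : ℂ) ^ 2 - z ^ 2) := by
    rw [sq_sub_sq, sq, mul_div_mul_left _ _ hne]
  rw [heq, norm_div, norm_pow, div_le_div_iff₀ h0 hκ]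
  have h2 : ‖(μ : ℂ) + z‖ ≤ μ + ‖z‖ := by
    simpa [abs_of_pos hμ] using norm_add_le (μ : ℂ) z
  have h3 : ‖(μ : ℂ) + z‖ ^ 2 ≤ 2 * μ ^ 2 + 2 * ‖z‖ ^ 2 := by
    nlinarith [sq_nonneg (μ - ‖z‖), norm_nonneg ((μ : ℂ) + z)]
  nlinarith

/-- The same factor is at most `1 + (12 / κ) * |z| / μ`. -/
theorem norm_add_div_sub_le_one_add {μ κ : ℝ} (hμ : 0 < μ) (hκ : 0 < κ) (hκ1 : κ ≤ 1) {z : ℂ}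
    (h : κ * μ ^ 2 ≤ ‖(μ : ℂ) ^ 2 - z ^ 2‖) :
    ‖((μ : ℂ) + z) / ((μ : ℂ) - z)‖ ≤ 1 + 12 / κ * (‖z‖ / μ) := by
  rcases le_or_gt (μ / 2) ‖z‖ with hz | hz
  · refine (norm_add_div_sub_le hμ hκ hκ1 h).trans ?_
    have : 1 / 2 ≤ ‖z‖ / μ := by rw [div_le_div_iff₀ two_pos hμ]; linarith
    have h12 : 12 / κ = 2 * (6 / κ) := by ring
    have : 0 < 6 / κ := by positivity
    nlinarith
  · have hsub : μ / 2 ≤ ‖(μ : ℂ) - z‖ := by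
      have := norm_sub_norm_le (μ : ℂ) z
      simp [abs_of_pos hμ] at this
      linarith
    have h0 : 0 < ‖(μ : ℂ) - z‖ := lt_of_lt_of_le (by positivity) hsub
    rw [norm_div, div_le_iff₀ h0]
    have h2 : ‖(μ : ℂ) + z‖ ≤ ‖(μ : ℂ) - z‖ + 2 * ‖z‖ := by
      have := norm_add_le ((μ : ℂ) - z) (2 * z)
      simp only [norm_mul, Complex.norm_ofNat] at this
      rwa [show (μ : ℂ) - z + 2 * z = μ + z by ring] at this
    have h4 : 2 * ‖z‖ ≤ 12 * (‖z‖ / μ) * ‖(μ : ℂ) - z‖ := by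
      calc 2 * ‖z‖ ≤ 6 * ‖z‖ := by linarith [norm_nonneg z]
        _ = 12 * (‖z‖ / μ) * (μ / 2) := by field_simp; ring
        _ ≤ _ := by gcongr
    have h5 : 12 * (‖z‖ / μ) ≤ 12 / κ * (‖z‖ / μ) := by
      gcongr
      rw [le_div_iff₀ hκ]; linarith
    nlinarith

/-- Since `∑ 1 / μ i` converges, the inverse Blaschke products grow slower than any exponential,
uniformly in the finite index set. -/
theorem exists_prod_le_exp {μ : ℕ → ℝ} (hμ : ∀ n, 0 < μ n) (hsum : Summable fun n => 1 / μ n)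
    {κ ε : ℝ} (hκ : 0 < κ) (hκ1 : κ ≤ 1) (hε : 0 < ε) :
    ∃ C : ℝ, 0 < C ∧ ∀ (N : ℕ) (z : ℂ),
      (∀ n < N, κ * μ n ^ 2 ≤ ‖(μ n : ℂ) ^ 2 - z ^ 2‖) →
      ∏ n ∈ Finset.range N, ‖((μ n : ℂ) + z) / ((μ n : ℂ) - z)‖ ≤ C * Real.exp (ε * ‖z‖) := by
  -- The first `m` factors contribute the constant `(6/κ)^m`; the others are at most `exp ((12/κ)
  -- |z| / μ n)`, and the tail of `∑ 1/μ n` makes their total exponent at most `ε |z|`.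
  obtain ⟨m, hm⟩ : ∃ m, ∑' k, 1 / μ (k + m) < ε / (12 / κ) :=
    ((tendsto_sum_nat_add fun n => 1 / μ n).eventually_lt_const (by positivity)).exists
  have hK : (1 : ℝ) ≤ 6 / κ := by rw [le_div_iff₀ hκ]; linarith
  refine ⟨(6 / κ) ^ m, by positivity, fun N z hz => ?_⟩
  have hstep : ∀ n ∈ Finset.range N, ‖((μ n : ℂ) + z) / ((μ n : ℂ) - z)‖ ≤
      (if n < m then 6 / κ else 1) *
        Real.exp (if n < m then 0 else 12 / κ * ‖z‖ * (1 / μ n)) := by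
    intro n hn
    split_ifs
    · simpa using norm_add_div_sub_le (hμ n) hκ hκ1 (hz n (Finset.mem_range.1 hn))
    · have := norm_add_div_sub_le_one_add (hμ n) hκ hκ1 (hz n (Finset.mem_range.1 hn))
      rw [one_mul]
      refine this.trans ?_
      have := Real.add_one_le_exp (12 / κ * ‖z‖ * (1 / μ n))
      rw [add_comm]
      rwa [show 12 / κ * (‖z‖ / μ n) = 12 / κ * ‖z‖ * (1 / μ n) by ring]
  refine (Finset.prod_le_prod (fun _ _ => norm_nonneg _) hstep).trans ?_
  rw [Finset.prod_mul_distrib, ← Real.exp_sum]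
  gcongr
  · rw [← Finset.prod_filter, Finset.prod_const]
    refine pow_le_pow_right₀ hK ?_
    calc _ ≤ (Finset.range m).card := Finset.card_le_card fun n hn => by
            simpa using (Finset.mem_filter.1 hn).2
      _ = m := Finset.card_range m
  · have hts : Summable fun k => 1 / μ (k + m) := (summable_nat_add_iff m).2 hsum
    calc ∑ n ∈ Finset.range N, (if n < m then 0 else 12 / κ * ‖z‖ * (1 / μ n))
        ≤ ∑ n ∈ Finset.range (m + N), (if n < m then 0 else 12 / κ * ‖z‖ * (1 / μ n)) := by
          refine Finset.sum_le_sum_of_subset_of_nonneg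
            (Finset.range_subset_range.2 (by omega)) fun n _ _ => ?_
          have := hμ n
          split_ifs <;> positivity
      _ = ∑ k ∈ Finset.range N, 12 / κ * ‖z‖ * (1 / μ (k + m)) := by
          rw [Finset.sum_range_add]
          rw [Finset.sum_eq_zero, zero_add]
          · refine Finset.sum_congr rfl fun k _ => ?_
            rw [if_neg (by omega), add_comm m k]
          · intro n hn
            rw [if_pos (Finset.mem_range.1 hn)]
      _ = 12 / κ * ‖z‖ * ∑ k ∈ Finset.range N, 1 / μ (k + m) := by rw [Finset.mul_sum]
      _ ≤ 12 / κ * ‖z‖ * (ε / (12 / κ)) := by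
          gcongr
          exact (hts.sum_le_tsum _ fun k _ => (one_div_pos.2 (hμ _)).le).trans hm.le
      _ = ε * ‖z‖ := by field_simp

/-! ### Circles in the variable `w = z⁻²` -/

/-- Points of a circle around `A` of radius just below `A` stay away from the points `v` of its
diameter. -/
theorem mul_norm_le_norm_sub_of_norm_sub_eq {A ρ v κ : ℝ} (hA : 0 < A) (hρ : 0 ≤ ρ) (hv : 0 < v)
    (h1 : A ^ 2 - ρ ^ 2 ≤ v * A) (hκ : 0 ≤ κ) (h2 : κ * (A + ρ) ≤ A + ρ - v) {w : ℂ}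
    (hw : ‖w - A‖ = ρ) : κ * ‖w‖ ≤ ‖w - v‖ := by
  have hwn : ‖w‖ ≤ A + ρ := by
    have := norm_add_le (w - A) (A : ℂ)
    simp [abs_of_pos hA] at this
    linarith
  rw [← sq_le_sq₀ (by positivity) (norm_nonneg _), mul_pow]
  have e1 : ‖w - v‖ ^ 2 = ‖w‖ ^ 2 - 2 * v * w.re + v ^ 2 := by
    rw [← Complex.normSq_eq_norm_sq, ← Complex.normSq_eq_norm_sq, Complex.normSq_apply,
      Complex.normSq_apply]
    simp
    ring
  have e2 : ρ ^ 2 = ‖w‖ ^ 2 - 2 * A * w.re + A ^ 2 := by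
    rw [← hw, ← Complex.normSq_eq_norm_sq, ← Complex.normSq_eq_norm_sq, Complex.normSq_apply,
      Complex.normSq_apply]
    simp
    ring
  set X := ‖w‖ ^ 2 with hX
  have hX0 : 0 ≤ X := by positivity
  have hX1 : X ≤ (A + ρ) ^ 2 := by rw [hX]; gcongr
  rw [e1]
  have e3 : 2 * w.re = (X + A ^ 2 - ρ ^ 2) / A := by field_simp; linarith
  -- On the circle `Re w` is affine in `X = |w|²`, hence so is `|w - v|² - κ²|w|²`. It suffices to
  -- check the sign at `X = 0` and `X = (A + ρ)²`, which are `f0` and `f1`.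
  have e4 : A * (X - 2 * v * w.re + v ^ 2 - κ ^ 2 * X) =
      X * (A - v - κ ^ 2 * A) + v * (v * A - (A ^ 2 - ρ ^ 2)) := by
    have : 2 * v * w.re = v * ((X + A ^ 2 - ρ ^ 2) / A) := by rw [← e3]; ring
    rw [this]
    field_simp
    ring
  have f0 : 0 ≤ v * (v * A - (A ^ 2 - ρ ^ 2)) := mul_nonneg hv.le (by linarith)
  have f1 : 0 ≤ (A + ρ) ^ 2 * (A - v - κ ^ 2 * A) + v * (v * A - (A ^ 2 - ρ ^ 2)) := by
    have : (A + ρ) ^ 2 * (A - v - κ ^ 2 * A) + v * (v * A - (A ^ 2 - ρ ^ 2)) =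
      A * ((A + ρ - v) ^ 2 - (κ * (A + ρ)) ^ 2) := by ring
    rw [this]
    refine mul_nonneg hA.le (sub_nonneg.2 ?_)
    gcongr
  have f2 : 0 ≤ (A + ρ) ^ 2 *
      (X * (A - v - κ ^ 2 * A) + v * (v * A - (A ^ 2 - ρ ^ 2))) := by
    have : (A + ρ) ^ 2 * (X * (A - v - κ ^ 2 * A) + v * (v * A - (A ^ 2 - ρ ^ 2))) =
      ((A + ρ) ^ 2 - X) * (v * (v * A - (A ^ 2 - ρ ^ 2))) +
        X * ((A + ρ) ^ 2 * (A - v - κ ^ 2 * A) + v * (v * A - (A ^ 2 - ρ ^ 2))) := by ring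
    rw [this]
    exact add_nonneg (mul_nonneg (by linarith) f0) (mul_nonneg hX0 f1)
  have f3 := nonneg_of_mul_nonneg_right f2 (by positivity)
  rw [← e4] at f3
  have := nonneg_of_mul_nonneg_right f3 hA
  linarith

/-- The branch `w ↦ w ^ (-1/2)` with values in the right half-plane. -/
noncomputable def invSqrt (w : ℂ) : ℂ := Complex.exp (-(Complex.log w / 2))

theorem invSqrt_sq {w : ℂ} (hw : w ≠ 0) : invSqrt w ^ 2 = w⁻¹ := by
  rw [invSqrt, ← Complex.exp_nat_mul]
  have : ((2 : ℕ) : ℂ) * -(Complex.log w / 2) = -Complex.log w := by push_cast; ring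
  rw [this, Complex.exp_neg, Complex.exp_log hw]

theorem invSqrt_ne_zero (w : ℂ) : invSqrt w ≠ 0 := Complex.exp_ne_zero _

theorem invSqrt_re_pos {w : ℂ} (hw : w ∈ Complex.slitPlane) : 0 < (invSqrt w).re := by
  rw [invSqrt, Complex.exp_re]
  refine mul_pos (Real.exp_pos _) (Real.cos_pos_of_mem_Ioo ?_)
  have h1 := Complex.neg_pi_lt_arg w
  have h2 := (Complex.arg_le_pi w).lt_of_ne (Complex.mem_slitPlane_iff_arg.1 hw).1
  have : (-(Complex.log w / 2)).im = -(w.arg / 2) := by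
    simp [Complex.log_im]
  rw [this]
  constructor <;> linarith

theorem differentiableAt_invSqrt {w : ℂ} (hw : w ∈ Complex.slitPlane) :
    DifferentiableAt ℂ invSqrt w := by
  unfold invSqrt
  exact ((DifferentiableAt.clog differentiableAt_id hw).div_const 2).neg.cexp

theorem invSqrt_ofReal_inv_sq {μ : ℝ} (hμ : 0 < μ) : invSqrt (((μ ^ 2)⁻¹ : ℝ) : ℂ) = μ := by
  rw [invSqrt, ← Complex.ofReal_log (by positivity), Real.log_inv, Real.log_pow]
  rw [show (-(((-(((2 : ℕ) : ℝ) * Real.log μ) : ℝ) : ℂ) / 2)) = ((Real.log μ : ℝ) : ℂ) by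
    push_cast; ring]
  rw [← Complex.ofReal_exp, Real.exp_log hμ]

/-- The disc with diameter `(0, δ⁻²)` is mapped by `w ↦ w ^ (-1/2)` into the region
`Re z ≥ max δ (|z| / 2)`. -/
theorem invSqrt_bounds {δ : ℝ} (hδ : 0 < δ) {w : ℂ} (hw : δ ^ 2 * ‖w‖ ^ 2 < w.re) :
    δ ≤ (invSqrt w).re ∧ ‖invSqrt w‖ ≤ 2 * (invSqrt w).re := by
  have hre : 0 < w.re := lt_of_le_of_lt (by positivity) hw
  have hpos := invSqrt_re_pos (Complex.mem_slitPlane_iff.2 (Or.inl hre))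
  have hw0 : w ≠ 0 := by rintro rfl; simp at hre
  have hn : 0 < ‖w‖ ^ 2 := by have := norm_pos_iff.2 hw0; positivity
  have hsq := congrArg Complex.re (invSqrt_sq hw0)
  rw [Complex.inv_re, Complex.normSq_eq_norm_sq, sq, Complex.mul_re] at hsq
  set z := invSqrt w
  have hlt : δ ^ 2 < w.re / ‖w‖ ^ 2 := by rwa [lt_div_iff₀ hn]
  constructor
  · rw [← sq_le_sq₀ hδ.le hpos.le]
    nlinarith [sq_nonneg z.im]
  · rw [← sq_le_sq₀ (norm_nonneg _) (by positivity), ← Complex.normSq_eq_norm_sq,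
      Complex.normSq_apply]
    nlinarith [sq_nonneg δ]

/-! ### Cauchy's formula and the decay of its kernel -/

/-- Comparison of a complex power with a real power of smaller exponent. -/
theorem norm_cpow_sub_cpow_le {r β : ℝ} (hβ : 0 < β) {ζ : ℂ} (hζ : β ≤ ζ.re)
    {x y : ℝ} (hx : x ∈ Ioc 0 r) (hy : y ∈ Ioc 0 r) :
    ‖(x : ℂ) ^ ζ - (y : ℂ) ^ ζ‖ ≤ ‖ζ‖ / β * r ^ (ζ.re - β) * |x ^ β - y ^ β| := by
  wlog hxy : y ≤ x generalizing x y
  · rw [norm_sub_rev, abs_sub_comm]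
    exact this hy hx (le_of_not_ge hxy)
  have hr : 0 < r := hx.1.trans_le hx.2
  have hζ0 : ζ ≠ 0 := by rintro rfl; simp at hζ; linarith
  have hf : ∀ u : ℝ, 0 < u → HasDerivAt (fun u : ℝ => (u : ℂ) ^ ζ - (y : ℂ) ^ ζ)
      (ζ * (u : ℂ) ^ (ζ - 1)) u := by
    intro u hu
    refine HasDerivAt.sub_const _ ?_
    have := (hasDerivAt_ofReal_cpow_const' hu.ne'
      (r := ζ - 1) (by intro h; apply hζ0; linear_combination h)).const_mul ζ
    refine this.congr_of_eventuallyEq (Eventually.of_forall fun t => ?_)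
    simp only [sub_add_cancel]
    rw [mul_div_cancel₀ _ hζ0]
  have hB : ∀ u : ℝ, 0 < u →
      HasDerivAt (fun u : ℝ => ‖ζ‖ / β * r ^ (ζ.re - β) * (u ^ β - y ^ β))
        (‖ζ‖ / β * r ^ (ζ.re - β) * (β * u ^ (β - 1))) u := fun u hu =>
    ((Real.hasDerivAt_rpow_const (Or.inl hu.ne')).sub_const _).const_mul _
  have hpos : ∀ u ∈ Icc y x, 0 < u := fun u hu => hy.1.trans_le hu.1
  rw [abs_of_nonneg (sub_nonneg.2 (Real.rpow_le_rpow hy.1.le hxy hβ.le))]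
  -- The derivative of `u ^ ζ` has modulus `|ζ| u^(Re ζ - 1) ≤ |ζ| r^(Re ζ - β) u^(β - 1)`, which is
  -- the derivative of the right-hand side.
  refine image_norm_le_of_norm_deriv_right_le_deriv_boundary'
    (fun u hu => (hf u (hpos u hu)).continuousAt.continuousWithinAt)
    (fun u hu => (hf u (hpos u (Ico_subset_Icc_self hu))).hasDerivWithinAt)
    (B := fun u : ℝ => ‖ζ‖ / β * r ^ (ζ.re - β) * (u ^ β - y ^ β))
    (by simp)
    (fun u hu => (hB u (hpos u hu)).continuousAt.continuousWithinAt)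
    (fun u hu => (hB u (hpos u (Ico_subset_Icc_self hu))).hasDerivWithinAt)
    ?_ (right_mem_Icc.2 hxy)
  · intro u hu
    have hu0 : 0 < u := hy.1.trans_le hu.1
    rw [norm_mul, Complex.norm_cpow_eq_rpow_re_of_pos hu0]
    have e : u ^ (ζ - 1).re = u ^ (ζ.re - β) * u ^ (β - 1) := by
      rw [← Real.rpow_add hu0]; congr 1; simp
    rw [e]
    have : u ^ (ζ.re - β) ≤ r ^ (ζ.re - β) :=
      Real.rpow_le_rpow hu0.le (hu.2.le.trans hx.2) (by linarith)
    calc ‖ζ‖ * (u ^ (ζ.re - β) * u ^ (β - 1)) ≤ ‖ζ‖ * (r ^ (ζ.re - β) * u ^ (β - 1)) := by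
          gcongr
      _ = _ := by field_simp

/-- Cauchy's formula for a pole at `μ`, pulled back by `w ↦ w ^ (-1/2)`. -/
theorem circleIntegral_invSqrt_of_mem {A ρ : ℝ} (hρ : 0 ≤ ρ) (hρA : ρ < A) {μ : ℝ} (hμ : 0 < μ)
    {Φ : ℂ → ℂ} (hΦ : Differentiable ℂ Φ) (hne : |(μ ^ 2)⁻¹ - A| ≠ ρ)
    (hout : ρ < |(μ ^ 2)⁻¹ - A| → Φ μ = 0) :
    (∮ w in C(A, ρ), invSqrt w ^ 3 / 2 * Φ (invSqrt w) / ((μ : ℂ) - invSqrt w)) =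
      2 * Real.pi * Complex.I * Φ μ := by
  set v : ℝ := (μ ^ 2)⁻¹ with hv
  have hv0 : 0 < v := by positivity
  -- With `z = w^(-1/2)` and `v = μ⁻²` one has `(w - v) z² μ² = (μ - z)(μ + z)`. So the integrand is
  -- `F w / (w - v)` with `F` holomorphic on the disc, and `F v = Φ μ`.
  set F : ℂ → ℂ := fun w => invSqrt w * (μ + invSqrt w) / (2 * μ ^ 2) * Φ (invSqrt w) with hF
  have hre : ∀ w ∈ Metric.closedBall (A : ℂ) ρ, 0 < w.re := by
    intro w hw
    rw [mem_closedBall_iff_norm] at hw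
    have := (abs_le.1 ((Complex.abs_re_le_norm _).trans hw)).1
    simp at this
    linarith
  have hFd : ∀ w ∈ Metric.closedBall (A : ℂ) ρ, DifferentiableAt ℂ F w := by
    intro w hw
    have h1 := differentiableAt_invSqrt (Complex.mem_slitPlane_iff.2 (Or.inl (hre w hw)))
    exact ((h1.mul (h1.const_add _)).div_const _).mul ((hΦ _).comp w h1)
  have hFv : F v = Φ μ := by
    have : (μ : ℂ) ≠ 0 := by exact_mod_cast hμ.ne'
    rw [hF]
    simp only
    rw [hv, invSqrt_ofReal_inv_sq hμ]
    field_simp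
    ring
  have hnorm : ‖(v : ℂ) - A‖ = |v - A| := by
    rw [← Complex.ofReal_sub, Complex.norm_real, Real.norm_eq_abs]
  have hcongr : (∮ w in C(A, ρ), invSqrt w ^ 3 / 2 * Φ (invSqrt w) / ((μ : ℂ) - invSqrt w)) =
      ∮ w in C(A, ρ), (w - v)⁻¹ • F w := by
    refine circleIntegral.integral_congr hρ fun w hw => ?_
    have hw' := Metric.sphere_subset_closedBall hw
    have hw0 : w ≠ 0 := by rintro rfl; simpa using hre _ hw'
    have hwv : w ≠ v := by
      rintro rfl
      rw [mem_sphere_iff_norm, hnorm] at hw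
      exact hne hw
    have hz0 := invSqrt_ne_zero w
    have hzs : w = (invSqrt w ^ 2)⁻¹ := by rw [invSqrt_sq hw0, inv_inv]
    have hμ0 : (μ : ℂ) ≠ 0 := by exact_mod_cast hμ.ne'
    have hvc : (v : ℂ) = ((μ : ℂ) ^ 2)⁻¹ := by rw [hv]; push_cast; rfl
    have hmul : (w - v) * (invSqrt w ^ 2 * μ ^ 2) = ((μ : ℂ) - invSqrt w) * (μ + invSqrt w) := by
      rw [hvc]
      nth_rewrite 1 [hzs]
      field_simp
      ring
    have hwv' : w - v ≠ 0 := sub_ne_zero.2 hwv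
    have hsub : (μ : ℂ) - invSqrt w ≠ 0 := by
      intro h
      rw [h, zero_mul] at hmul
      exact (mul_ne_zero hwv' (by positivity)) hmul
    simp only [hF, smul_eq_mul]
    rw [← div_eq_inv_mul, div_eq_div_iff hsub hwv']
    calc invSqrt w ^ 3 / 2 * Φ (invSqrt w) * (w - v)
        = invSqrt w / (2 * μ ^ 2) * Φ (invSqrt w) * ((w - v) * (invSqrt w ^ 2 * μ ^ 2)) := by
          field_simp
      _ = _ := by rw [hmul]; ring
  rw [hcongr]
  rcases lt_or_gt_of_ne hne with h | h
  · rw [Complex.circleIntegral_sub_inv_smul_of_differentiable_on_off_countable countable_empty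
      (by rw [mem_ball_iff_norm, hnorm]; exact h)
      (fun w hw => (hFd w hw).continuousAt.continuousWithinAt)
      (fun w hw => hFd w (Metric.ball_subset_closedBall hw.1)), hFv, smul_eq_mul]
  · rw [hout h, mul_zero]
    have hd : ∀ w ∈ Metric.closedBall (A : ℂ) ρ,
        DifferentiableAt ℂ (fun w : ℂ => (w - v)⁻¹ • F w) w := by
      intro w hw
      have h1 : DifferentiableAt ℂ (fun w : ℂ => w - v) w := by fun_prop
      refine (h1.fun_inv ?_).fun_smul (hFd w hw)
      rw [sub_ne_zero]
      rintro rfl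
      rw [mem_closedBall_iff_norm, hnorm] at hw
      exact absurd hw (not_le.2 h)
    exact Complex.circleIntegral_eq_zero_of_differentiable_on_off_countable hρ countable_empty
      (fun w hw => (hd w hw).continuousAt.continuousWithinAt)
      (fun w hw => hd w (Metric.ball_subset_closedBall hw.1))

theorem mul_sq_le_norm_sq_sub_sq {μ κ : ℝ} (hμ : 0 < μ) {w : ℂ} (hw : w ≠ 0)
    (h : κ * ‖w‖ ≤ ‖w - (((μ ^ 2)⁻¹ : ℝ) : ℂ)‖) :
    κ * μ ^ 2 ≤ ‖(μ : ℂ) ^ 2 - invSqrt w ^ 2‖ := by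
  have hμ0 : (μ : ℂ) ≠ 0 := by exact_mod_cast hμ.ne'
  rw [invSqrt_sq hw]
  have e : (μ : ℂ) ^ 2 - w⁻¹ = (w - (((μ ^ 2)⁻¹ : ℝ) : ℂ)) * (μ ^ 2 * w⁻¹) := by
    push_cast
    field_simp
  rw [e, norm_mul, norm_mul, norm_pow, Complex.norm_real, Real.norm_eq_abs, abs_of_pos hμ, norm_inv]
  have : 0 < ‖w‖ := norm_pos_iff.2 hw
  calc κ * μ ^ 2 = (κ * ‖w‖) * (μ ^ 2 * ‖w‖⁻¹) := by field_simp
    _ ≤ _ := by gcongr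

/-- On the contours, the kernel decays uniformly. -/
theorem exists_kernel_bound {r δ μ₀ : ℝ} (hr : 0 < r) (hr1 : r < 1) (hμ₀ : 0 < μ₀) (hδ : μ₀ < δ)
    {C₁ : ℝ} (hC₁ : 0 < C₁) :
    ∃ C : ℝ, 0 < C ∧ ∀ z : ℂ, δ ≤ z.re → ‖z‖ ≤ 2 * z.re → ∀ x ∈ Ioc 0 r, ∀ y ∈ Ioc 0 r,
      ‖z‖ ^ 3 / 2 * ‖(x : ℂ) ^ (z - μ₀) - (y : ℂ) ^ (z - μ₀)‖ *
        (C₁ * Real.exp (-Real.log r / 4 * ‖z‖)) ≤ C * |x ^ (δ - μ₀) - y ^ (δ - μ₀)| := by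
  set c := -Real.log r with hc
  have hc0 : 0 < c := neg_pos.2 (Real.log_neg hr hr1)
  have hβ : 0 < δ - μ₀ := sub_pos.2 hδ
  -- Since `Re z ≥ |z|/2`, the kernel brings `exp (-c|z|/2)`. Half of this rate absorbs the growth
  -- `exp (c|z|/4)` in the statement, the other half absorbs `|z|⁴` through `t⁴/4! ≤ exp t` at `t =
  -- c|z|/4`.
  refine ⟨C₁ / (δ - μ₀) * r ^ (-δ) * (24 * (4 / c) ^ 4), by positivity, fun z hz1 hz2 x hx y hy => ?_⟩
  have hk := norm_cpow_sub_cpow_le (r := r) hβ (ζ := z - μ₀) (by simpa using hz1) hx hy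
  have hzn : z.re ≤ ‖z‖ := Complex.re_le_norm z
  have h1 : ‖z - μ₀‖ ≤ 2 * ‖z‖ := by
    have := norm_sub_le z (μ₀ : ℂ)
    simp [abs_of_pos hμ₀] at this
    linarith
  have h2 : r ^ ((z - μ₀).re - (δ - μ₀)) ≤ r ^ (-δ) * Real.exp (-(c / 2) * ‖z‖) := by
    have : (z - μ₀).re - (δ - μ₀) = -δ + z.re := by simp; ring
    rw [this, Real.rpow_add hr]
    gcongr
    rw [Real.rpow_def_of_pos hr]
    exact Real.exp_le_exp.2 (by nlinarith)
  have h3 : ‖z‖ ^ 4 ≤ 24 * (4 / c) ^ 4 * Real.exp (c / 4 * ‖z‖) := by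
    have := Real.pow_div_factorial_le_exp (c / 4 * ‖z‖) (by positivity) 4
    rw [div_le_iff₀ (by positivity)] at this
    have e : ‖z‖ ^ 4 = (4 / c) ^ 4 * (c / 4 * ‖z‖) ^ 4 := by field_simp
    rw [e]
    calc (4 / c) ^ 4 * (c / 4 * ‖z‖) ^ 4
        ≤ (4 / c) ^ 4 * (Real.exp (c / 4 * ‖z‖) * (Nat.factorial 4)) := by gcongr
      _ = _ := by norm_num [Nat.factorial]; ring
  calc ‖z‖ ^ 3 / 2 * ‖(x : ℂ) ^ (z - μ₀) - (y : ℂ) ^ (z - μ₀)‖ * (C₁ * Real.exp (c / 4 * ‖z‖))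
      ≤ ‖z‖ ^ 3 / 2 * (2 * ‖z‖ / (δ - μ₀) * (r ^ (-δ) * Real.exp (-(c / 2) * ‖z‖)) *
          |x ^ (δ - μ₀) - y ^ (δ - μ₀)|) * (C₁ * Real.exp (c / 4 * ‖z‖)) := by
        gcongr
        exact hk.trans (by gcongr)
    _ = C₁ / (δ - μ₀) * r ^ (-δ) * ‖z‖ ^ 4 * |x ^ (δ - μ₀) - y ^ (δ - μ₀)| *
          (Real.exp (-(c / 2) * ‖z‖) * Real.exp (c / 4 * ‖z‖)) := by
        field_simp
    _ ≤ C₁ / (δ - μ₀) * r ^ (-δ) * (24 * (4 / c) ^ 4 * Real.exp (c / 4 * ‖z‖)) *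
          |x ^ (δ - μ₀) - y ^ (δ - μ₀)| *
          (Real.exp (-(c / 2) * ‖z‖) * Real.exp (c / 4 * ‖z‖)) := by
        gcongr
    _ = C₁ / (δ - μ₀) * r ^ (-δ) * (24 * (4 / c) ^ 4) * |x ^ (δ - μ₀) - y ^ (δ - μ₀)| *
          (Real.exp (c / 4 * ‖z‖ + (-(c / 2) * ‖z‖ + c / 4 * ‖z‖))) := by
        rw [Real.exp_add, Real.exp_add]; ring
    _ = _ := by
        rw [show c / 4 * ‖z‖ + (-(c / 2) * ‖z‖ + c / 4 * ‖z‖) = 0 by ring, Real.exp_zero, mul_one]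

/-! ### The contour integral and the Hölder bound -/

/-- Hölder bound for Müntz polynomials divided by their lowest monomial, in terms of the Mellin
transform on a vertical line, uniformly in the degree. -/
theorem exists_holder_bound_of_mellin {μ : ℕ → ℝ} (hμ : ∀ n, 0 < μ n) (hmono : StrictMono μ)
    (hsum : Summable fun n => 1 / μ n) {r : ℝ} (hr : 0 < r) (hr1 : r < 1) :
    ∃ β C : ℝ, 0 < β ∧ 0 < C ∧ ∀ (N : ℕ) (b : ℕ → ℂ) (A : ℝ),
      (∀ y : ℝ, ‖∑ n ∈ Finset.range N, b n / ((μ n : ℂ) - y * Complex.I)‖ ≤ A) →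
      ∀ x ∈ Ioc 0 r, ∀ y ∈ Ioc 0 r,
        ‖∑ n ∈ Finset.range N, b n * ((x : ℂ) ^ ((μ n : ℂ) - μ 0) - (y : ℂ) ^ ((μ n : ℂ) - μ 0))‖ ≤
          C * A * |x ^ β - y ^ β| := by
  -- The contour must separate `μ 0` from the other poles; the room between `μ 0` and `δ` becomes
  -- the Hölder exponent.
  set δ := (μ 0 + μ 1) / 2 with hδ
  have h01 : μ 0 < μ 1 := hmono zero_lt_one
  have hδ0 : μ 0 < δ := by rw [hδ]; linarith
  have hδ1 : δ < μ 1 := by rw [hδ]; linarith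
  have hδpos : 0 < δ := (hμ 0).trans hδ0
  set D := (δ ^ 2)⁻¹ with hD
  have hDpos : 0 < D := by positivity
  -- In the variable `w = z⁻²` the poles decrease inside a bounded interval: all but `v 0` lie in
  -- `(0, D)`, so one circle can enclose `v 1, …, v (N - 1)`.
  set v : ℕ → ℝ := fun n => (μ n ^ 2)⁻¹ with hv
  have hvpos : ∀ n, 0 < v n := fun n => by have := hμ n; positivity
  have hvanti : StrictAnti v := by
    intro a b hab
    have := hμ a
    have := hmono hab
    simp only [hv]
    gcongr
  have hv1 : v 1 < D := by simp only [hv, hD]; gcongr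
  have hv0 : D < v 0 := by have := hμ 0; simp only [hv, hD]; gcongr
  -- The separation constant depends only on `v 0`, `v 1` and `D`, not on `N`; this makes the final
  -- bound uniform in the degree.
  set κ := min (min ((D - v 1) / (D + v 1)) ((v 0 - D) / D)) 1 with hκ
  have hκ0 : 0 < κ := by
    have := hvpos 1
    refine lt_min (lt_min (div_pos ?_ ?_) (div_pos ?_ ?_)) one_pos <;> linarith
  have hκ1 : κ ≤ 1 := min_le_right _ _
  have hκa : κ * (D + v 1) ≤ D - v 1 := by
    have := hvpos 1
    rw [← le_div_iff₀ (by linarith)]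
    exact (min_le_left _ _).trans (min_le_left _ _)
  have hκb : κ * D ≤ v 0 - D := by
    rw [← le_div_iff₀ hDpos]
    exact (min_le_left _ _).trans (min_le_right _ _)
  have hlog : 0 < -Real.log r / 4 := div_pos (neg_pos.2 (Real.log_neg hr hr1)) (by norm_num)
  obtain ⟨C₁, hC₁, hprod⟩ := exists_prod_le_exp hμ hsum hκ0 hκ1 hlog
  obtain ⟨C₂, hC₂, hker⟩ := exists_kernel_bound hr hr1 (hμ 0) hδ0 hC₁
  refine ⟨δ - μ 0, D * C₂, sub_pos.2 hδ0, by positivity, fun N b A hA x hx y hy => ?_⟩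
  have hA0 : 0 ≤ A := (norm_nonneg _).trans (hA 0)
  -- The circle has diameter `(η, D - η)`: `η` lies below every pole used, and `D - η` stays at
  -- least halfway from `v 1` to `D`.
  set η := min (v N / 2) ((D - v 1) / 2) with hη
  have hη0 : 0 < η := lt_min (half_pos (hvpos N)) (half_pos (by linarith))
  have hηv : ∀ n < N, 2 * η < v n := fun n hn => by
    have h1 := hvanti hn
    have h2 := hvpos N
    have : η ≤ v N / 2 := min_le_left _ _
    linarith
  have hηD : η ≤ (D - v 1) / 2 := min_le_right _ _
  have hv1pos := hvpos 1
  set R := D / 2 - η with hR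
  have hR0 : 0 < R := by linarith
  have hRA : R < D / 2 := by linarith
  set Φ : ℂ → ℂ := fun z => (x : ℂ) ^ (z - μ 0) - (y : ℂ) ^ (z - μ 0) with hΦ
  have hΦd : Differentiable ℂ Φ := by
    intro z
    have hx0 : (x : ℂ) ≠ 0 := by exact_mod_cast hx.1.ne'
    have hy0 : (y : ℂ) ≠ 0 := by exact_mod_cast hy.1.ne'
    exact (DifferentiableAt.const_cpow (by fun_prop) (Or.inl hx0)).sub
      (DifferentiableAt.const_cpow (by fun_prop) (Or.inl hy0))
  have hne : ∀ n < N, |v n - D / 2| ≠ R := by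
    intro n hn h
    have := hηv n hn
    rcases Nat.eq_zero_or_pos n with rfl | hn0
    · rw [abs_of_pos (by linarith)] at h; linarith
    · have : v n ≤ v 1 := hvanti.antitone hn0
      have : |v n - D / 2| < R := abs_lt.2 ⟨by linarith, by linarith⟩
      linarith
  have hint : ∀ n < N, (∮ w in C((D / 2 : ℝ), R),
      invSqrt w ^ 3 / 2 * Φ (invSqrt w) / ((μ n : ℂ) - invSqrt w)) =
      2 * Real.pi * Complex.I * Φ (μ n) := by
    intro n hn
    refine circleIntegral_invSqrt_of_mem hR0.le hRA (hμ n) hΦd (hne n hn) fun h => ?_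
    rcases Nat.eq_zero_or_pos n with rfl | hn0
    -- The pole `v 0` is outside the circle, but `Φ (μ 0) = 0`, so nothing is lost.
    · simp [hΦ]
    · exfalso
      have h1 : v n ≤ v 1 := hvanti.antitone hn0
      have h2 := hηv n hn
      have : |v n - D / 2| < R := abs_lt.2 ⟨by linarith, by linarith⟩
      exact lt_asymm h this
  have hre : ∀ w ∈ Metric.sphere ((D / 2 : ℝ) : ℂ) R, δ ^ 2 * ‖w‖ ^ 2 < w.re := by
    intro w hw
    rw [mem_sphere_iff_norm] at hw
    have e2 : R ^ 2 = ‖w‖ ^ 2 - D * w.re + (D / 2) ^ 2 := by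
      rw [← hw, ← Complex.normSq_eq_norm_sq, ← Complex.normSq_eq_norm_sq, Complex.normSq_apply,
        Complex.normSq_apply]
      simp
      ring
    have : R ^ 2 < (D / 2) ^ 2 := by gcongr
    have h3 : ‖w‖ ^ 2 < D * w.re := by linarith
    calc δ ^ 2 * ‖w‖ ^ 2 < δ ^ 2 * (D * w.re) := by gcongr
      _ = w.re := by rw [hD]; field_simp
  have hw0 : ∀ w ∈ Metric.sphere ((D / 2 : ℝ) : ℂ) R, w ≠ 0 := by
    rintro w hw rfl
    simpa using hre 0 hw
  have hdist : ∀ w ∈ Metric.sphere ((D / 2 : ℝ) : ℂ) R, ∀ n < N,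
      κ * μ n ^ 2 ≤ ‖(μ n : ℂ) ^ 2 - invSqrt w ^ 2‖ := by
    intro w hw n hn
    refine mul_sq_le_norm_sq_sub_sq (hμ n) (hw0 w hw) ?_
    rw [mem_sphere_iff_norm] at hw
    change κ * ‖w‖ ≤ ‖w - (v n : ℂ)‖
    rcases Nat.eq_zero_or_pos n with rfl | hn0
    · have h1 : ‖w‖ ≤ D := by
        have := norm_add_le (w - (D / 2 : ℝ)) ((D / 2 : ℝ) : ℂ)
        rw [sub_add_cancel, hw, Complex.norm_real, Real.norm_eq_abs,
          abs_of_pos (half_pos hDpos)] at this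
        linarith
      have h2 := norm_sub_norm_le (v 0 : ℂ) w
      rw [norm_sub_rev, Complex.norm_real, Real.norm_eq_abs, abs_of_pos (hvpos 0)] at h2
      nlinarith
    · have h1 : v n ≤ v 1 := hvanti.antitone hn0
      have h2 := hηv n hn
      refine mul_norm_le_norm_sub_of_norm_sub_eq (half_pos hDpos) hR0.le (hvpos n) ?_ hκ0.le ?_ hw
      · rw [hR]; nlinarith
      · have : D / 2 + R = D - η := by rw [hR]; ring
        rw [this]
        nlinarith
  have hsub : ∀ w ∈ Metric.sphere ((D / 2 : ℝ) : ℂ) R, ∀ n < N, invSqrt w ≠ μ n := by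
    intro w hw n hn h
    have h1 := hdist w hw n hn
    rw [h, sub_self, norm_zero] at h1
    have := hμ n
    have : 0 < κ * μ n ^ 2 := by positivity
    linarith
  have hcont : ∀ n < N, CircleIntegrable (fun w => b n *
      (invSqrt w ^ 3 / 2 * Φ (invSqrt w) / ((μ n : ℂ) - invSqrt w))) ((D / 2 : ℝ) : ℂ) R := by
    intro n hn
    refine ContinuousOn.circleIntegrable hR0.le fun w hw => ContinuousAt.continuousWithinAt ?_
    have h1 := (differentiableAt_invSqrt (Complex.mem_slitPlane_iff.2
      (Or.inl (lt_of_le_of_lt (by positivity) (hre w hw))))).continuousAt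
    refine continuousAt_const.mul (ContinuousAt.div (((h1.pow 3).div_const 2).mul
      (ContinuousAt.comp (g := Φ) hΦd.continuous.continuousAt h1)) (continuousAt_const.sub h1)
      (sub_ne_zero.2 (hsub w hw n hn).symm))
  have hsumint : (∮ w in C((D / 2 : ℝ), R), ∑ n ∈ Finset.range N, b n *
      (invSqrt w ^ 3 / 2 * Φ (invSqrt w) / ((μ n : ℂ) - invSqrt w))) =
      2 * Real.pi * Complex.I * ∑ n ∈ Finset.range N, b n * Φ (μ n) := by
    rw [circleIntegral.integral_fun_sum fun n hn => hcont n (Finset.mem_range.1 hn), Finset.mul_sum]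
    refine Finset.sum_congr rfl fun n hn => ?_
    rw [circleIntegral.integral_const_mul, hint n (Finset.mem_range.1 hn)]
    ring
  have hbound : ∀ w ∈ Metric.sphere ((D / 2 : ℝ) : ℂ) R, ‖∑ n ∈ Finset.range N, b n *
      (invSqrt w ^ 3 / 2 * Φ (invSqrt w) / ((μ n : ℂ) - invSqrt w))‖ ≤
      C₂ * |x ^ (δ - μ 0) - y ^ (δ - μ 0)| * A := by
    intro w hw
    have e : ∑ n ∈ Finset.range N, b n *
        (invSqrt w ^ 3 / 2 * Φ (invSqrt w) / ((μ n : ℂ) - invSqrt w)) =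
        invSqrt w ^ 3 / 2 * Φ (invSqrt w) *
          ∑ n ∈ Finset.range N, b n / ((μ n : ℂ) - invSqrt w) := by
      rw [Finset.mul_sum]
      exact Finset.sum_congr rfl fun n _ => by ring
    obtain ⟨hz1, hz2⟩ := invSqrt_bounds hδpos (hre w hw)
    have h1 := norm_sum_div_le_mul_prod (Finset.range N) μ (fun i _ => hμ i) b hA
      (hδpos.trans_le hz1) (fun i hi => hsub w hw i (Finset.mem_range.1 hi))
    have h2 := hprod N (invSqrt w) (hdist w hw)
    have h3 := hker (invSqrt w) hz1 hz2 x hx y hy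
    rw [e, norm_mul, norm_mul, norm_div, norm_pow, Complex.norm_ofNat]
    calc _ ≤ ‖invSqrt w‖ ^ 3 / 2 * ‖Φ (invSqrt w)‖ *
          (A * (C₁ * Real.exp (-Real.log r / 4 * ‖invSqrt w‖))) := by
          gcongr
          exact h1.trans (by gcongr)
      _ = ‖invSqrt w‖ ^ 3 / 2 * ‖Φ (invSqrt w)‖ *
          (C₁ * Real.exp (-Real.log r / 4 * ‖invSqrt w‖)) * A := by ring
      _ ≤ _ := by gcongr
  have hfin := circleIntegral.norm_integral_le_of_norm_le_const hR0.le hbound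
  rw [hsumint, norm_mul] at hfin
  have hpi : ‖(2 * Real.pi * Complex.I : ℂ)‖ = 2 * Real.pi := by
    simp [abs_of_pos Real.pi_pos]
  rw [hpi, mul_assoc (2 * Real.pi)] at hfin
  have hfin' := le_of_mul_le_mul_left hfin (by positivity)
  refine hfin'.trans ?_
  calc R * (C₂ * |x ^ (δ - μ 0) - y ^ (δ - μ 0)| * A)
      ≤ D * (C₂ * |x ^ (δ - μ 0) - y ^ (δ - μ 0)| * A) := by gcongr; linarith
    _ = _ := by ring

/-! ### Mellin transforms and bounds for Müntz polynomials -/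

/-- Lets polynomials over `𝕜` go through the complex-analytic estimate without change of norms. -/
theorem RCLike.norm_map_complex {𝕜 : Type*} [RCLike 𝕜] (a : 𝕜) : ‖RCLike.map 𝕜 ℂ a‖ = ‖a‖ := by
  rw [← sq_eq_sq₀ (norm_nonneg _) (norm_nonneg _), ← RCLike.normSq_eq_def', ← RCLike.normSq_eq_def',
    RCLike.normSq_apply, RCLike.normSq_apply]
  simp [RCLike.map]

theorem unitInterval.integral_cpow {s : ℂ} (hs : 0 < s.re) :
    ∫ x : I, ((x : ℝ) : ℂ) ^ s = 1 / (s + 1) := by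
  rw [unitInterval.measurePreserving_coe.integral_comp unitInterval.measurableEmbedding_coe
    (fun x : ℝ => (x : ℂ) ^ s), integral_Icc_eq_integral_Ioc,
    ← intervalIntegral.integral_of_le zero_le_one, _root_.integral_cpow (Or.inl (by linarith))]
  have : s + 1 ≠ 0 := by
    intro h
    have := congrArg Complex.re h
    simp at this
    linarith
  simp [Complex.zero_cpow this]

theorem unitInterval.integrable_of_continuous {E : Type*} [NormedAddCommGroup E] {f : I → E}
    (hf : Continuous f) : Integrable f :=
  hf.integrable_of_hasCompactSupport (HasCompactSupport.of_compactSpace f)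

section Muntz

variable {𝕜 : Type*} [RCLike 𝕜] {Λ : ℕ → ℝ}

theorem continuous_muntzMonomial {a : ℝ} (ha : 0 < a) : Continuous (muntzMonomial 𝕜 a) := by
  unfold muntzMonomial
  exact RCLike.continuous_ofReal.comp
    (Real.continuous_rpow_const ha.le |>.comp continuous_subtype_val)

theorem exists_eq_sum_of_mem_muntzPolynomials {p : I → 𝕜}
    (hp : p ∈ muntzPolynomials 𝕜 Λ) :
    ∃ (N : ℕ) (b : ℕ → 𝕜), p = fun x => ∑ n ∈ Finset.range N, b n * muntzMonomial 𝕜 (Λ n) x := by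
  obtain ⟨c, rfl⟩ := Finsupp.mem_span_range_iff_exists_finsupp.1 hp
  refine ⟨c.support.sup id + 1, c, ?_⟩
  ext x
  rw [Finsupp.sum, Finset.sum_apply]
  refine Finset.sum_subset_zero_on_sdiff (fun n hn => ?_) (fun n hn => ?_) fun n _ => rfl
  · exact Finset.mem_range.2 (Nat.lt_succ_of_le (Finset.le_sup (f := id) hn))
  · rw [Finsupp.notMem_support_iff.1 (Finset.mem_sdiff.1 hn).2, zero_mul]

theorem continuous_of_mem_muntzPolynomials (hΛ : ∀ n, 0 < Λ n) {p : I → 𝕜}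
    (hp : p ∈ muntzPolynomials 𝕜 Λ) : Continuous p := by
  obtain ⟨N, b, rfl⟩ := exists_eq_sum_of_mem_muntzPolynomials hp
  exact continuous_finsetSum _ fun n _ => continuous_const.mul (continuous_muntzMonomial (hΛ n))

/-- The Mellin transform of a Müntz polynomial is a partial fraction. -/
theorem norm_sum_div_le_integral (hΛ : ∀ n, 0 < Λ n) (N : ℕ) (b : ℕ → ℂ) (y : ℝ) :
    ‖∑ n ∈ Finset.range N, b n / (((Λ n + 1 : ℝ) : ℂ) - y * Complex.I)‖ ≤
      ∫ x : I, ‖∑ n ∈ Finset.range N, b n * (((x : ℝ) ^ Λ n : ℝ) : ℂ)‖ := by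
  have hcont : ∀ n, Continuous fun x : I => ((x : ℝ) : ℂ) ^ ((Λ n : ℂ) - y * Complex.I) := fun n =>
    (Complex.continuous_ofReal_cpow_const (by simpa using hΛ n)).comp continuous_subtype_val
  have hint : ∀ n, ∫ x : I, ((x : ℝ) : ℂ) ^ ((Λ n : ℂ) - y * Complex.I) =
      1 / (((Λ n + 1 : ℝ) : ℂ) - y * Complex.I) := by
    intro n
    rw [unitInterval.integral_cpow (by simpa using hΛ n)]
    push_cast
    ring_nf
  have : ∑ n ∈ Finset.range N, b n / (((Λ n + 1 : ℝ) : ℂ) - y * Complex.I) =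
      ∫ x : I, ∑ n ∈ Finset.range N, b n * ((x : ℝ) : ℂ) ^ ((Λ n : ℂ) - y * Complex.I) := by
    rw [integral_finsetSum]
    · refine Finset.sum_congr rfl fun n _ => ?_
      rw [integral_const_mul, hint, mul_one_div]
    · exact fun n _ => unitInterval.integrable_of_continuous (continuous_const.mul (hcont n))
  rw [this]
  refine (norm_integral_le_integral_norm _).trans (le_of_eq ?_)
  refine integral_congr_ae ?_
  filter_upwards [Measure.ae_ne volume (0 : I)] with x hx
  have hx0 : 0 < (x : ℝ) := unitInterval.pos_iff_ne_zero.2 hx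
  have hxc : ((x : ℝ) : ℂ) ≠ 0 := by exact_mod_cast hx0.ne'
  have e : ∑ n ∈ Finset.range N, b n * ((x : ℝ) : ℂ) ^ ((Λ n : ℂ) - y * Complex.I) =
      (∑ n ∈ Finset.range N, b n * (((x : ℝ) ^ Λ n : ℝ) : ℂ)) *
        ((x : ℝ) : ℂ) ^ (-(y * Complex.I)) := by
    rw [Finset.sum_mul]
    refine Finset.sum_congr rfl fun n _ => ?_
    rw [sub_eq_add_neg, Complex.cpow_add _ _ hxc, Complex.ofReal_cpow hx0.le, mul_assoc]
  rw [e, norm_mul, Complex.norm_cpow_eq_rpow_re_of_pos hx0]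
  simp

/-- Müntz polynomials divided by their lowest monomial satisfy a Hölder bound away from `1`, in
terms of the `L¹` norm. -/
theorem exists_muntzPolynomials_holder_bound (𝕜 : Type*) [RCLike 𝕜]
    (hΛ : ∀ n, 0 < Λ n) (hmono : StrictMono Λ) (hsum : Summable fun n => 1 / Λ n)
    {r : ℝ} (hr : 0 < r) (hr1 : r < 1) :
    ∃ β C : ℝ, 0 < β ∧ 0 < C ∧ ∀ p ∈ muntzPolynomials 𝕜 Λ,
      ∀ x : I, (x : ℝ) ∈ Ioc 0 r → ∀ y : I, (y : ℝ) ∈ Ioc 0 r →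
        ‖((x : ℝ) ^ (-Λ 0)) • p x - ((y : ℝ) ^ (-Λ 0)) • p y‖ ≤
          C * (∫ t : I, ‖p t‖) * |(x : ℝ) ^ β - (y : ℝ) ^ β| := by
  have hsum' : Summable fun n => 1 / (Λ n + 1) := by
    refine hsum.of_nonneg_of_le (fun n => ?_) fun n => ?_
    · have := hΛ n; positivity
    · have := hΛ n
      gcongr
      linarith
  -- The Mellin poles sit at `Λ n + 1`; the shift cancels in the exponents `μ n - μ 0`.
  obtain ⟨β, C, hβ, hC, h⟩ := exists_holder_bound_of_mellin (μ := fun n => Λ n + 1)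
    (fun n => by have := hΛ n; positivity) (fun a b hab => by simpa using hmono hab) hsum' hr hr1
  refine ⟨β, C, hβ, hC, fun p hp x hx y hy => ?_⟩
  obtain ⟨N, b, rfl⟩ := exists_eq_sum_of_mem_muntzPolynomials hp
  have hmap : ∀ (t : I) (c : ℝ), RCLike.map 𝕜 ℂ
      (c • ∑ n ∈ Finset.range N, b n * muntzMonomial 𝕜 (Λ n) t) =
      c * ∑ n ∈ Finset.range N, RCLike.map 𝕜 ℂ (b n) * (((t : ℝ) ^ Λ n : ℝ) : ℂ) := by
    intro t c
    rw [map_smul, map_sum, Complex.real_smul]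
    congr 1
    refine Finset.sum_congr rfl fun n _ => ?_
    rw [muntzMonomial, mul_comm, ← RCLike.real_smul_eq_coe_mul, map_smul, Complex.real_smul,
      mul_comm]
  have hA : ∀ y : ℝ, ‖∑ n ∈ Finset.range N,
      RCLike.map 𝕜 ℂ (b n) / (((Λ n + 1 : ℝ) : ℂ) - y * Complex.I)‖ ≤
      ∫ t : I, ‖∑ n ∈ Finset.range N, b n * muntzMonomial 𝕜 (Λ n) t‖ := by
    intro y
    refine (norm_sum_div_le_integral hΛ N _ y).trans (le_of_eq ?_)
    congr 1
    ext t
    rw [← RCLike.norm_map_complex (∑ n ∈ Finset.range N, b n * muntzMonomial 𝕜 (Λ n) t)]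
    have := hmap t 1
    rw [one_smul, Complex.ofReal_one, one_mul] at this
    rw [this]
  have key := h N (fun n => RCLike.map 𝕜 ℂ (b n)) _ hA x hx y hy
  refine le_trans (le_of_eq ?_) key
  rw [← RCLike.norm_map_complex, map_sub, hmap, hmap, Finset.mul_sum, Finset.mul_sum,
    ← Finset.sum_sub_distrib]
  congr 1
  refine Finset.sum_congr rfl fun n _ => ?_
  have hpow : ∀ t : ℝ, 0 < t → (t : ℂ) ^ (((Λ n + 1 : ℝ) : ℂ) - ((Λ 0 + 1 : ℝ) : ℂ)) =
      ((t ^ (-Λ 0) : ℝ) : ℂ) * ((t ^ Λ n : ℝ) : ℂ) := by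
    intro t ht
    rw [← Complex.ofReal_mul, ← Real.rpow_add ht, Complex.ofReal_cpow ht.le]
    congr 1
    push_cast
    ring
  rw [hpow _ hx.1, hpow _ hy.1]
  ring

theorem apply_zero_of_mem_muntzPolynomials (hΛ : ∀ n, 0 < Λ n) {p : I → 𝕜}
    (hp : p ∈ muntzPolynomials 𝕜 Λ) : p 0 = 0 := by
  obtain ⟨N, b, rfl⟩ := exists_eq_sum_of_mem_muntzPolynomials hp
  refine Finset.sum_eq_zero fun n _ => ?_
  simp [muntzMonomial, Real.zero_rpow (hΛ n).ne']

/-- Müntz polynomials are bounded away from `1` by their `L¹` norm times their lowest monomial. -/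
theorem exists_muntzPolynomials_bound (𝕜 : Type*) [RCLike 𝕜]
    (hΛ : ∀ n, 0 < Λ n) (hmono : StrictMono Λ) (hsum : Summable fun n => 1 / Λ n)
    {r : ℝ} (hr : 0 < r) (hr1 : r < 1) :
    ∃ C : ℝ, 0 < C ∧ ∀ p ∈ muntzPolynomials 𝕜 Λ, ∀ x : I, (x : ℝ) ≤ r →
        ‖p x‖ ≤ C * (x : ℝ) ^ Λ 0 * ∫ t : I, ‖p t‖ := by
  obtain ⟨β, C, hβ, hC, h⟩ := exists_muntzPolynomials_holder_bound 𝕜 hΛ hmono hsum hr hr1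
  refine ⟨(r / 2) ^ (-Λ 0) * (2 / r) + C, by positivity, fun p hp x hx => ?_⟩
  set A := ∫ t : I, ‖p t‖ with hA
  have hA0 : 0 ≤ A := integral_nonneg fun _ => norm_nonneg _
  rcases (show 0 ≤ (x : ℝ) from x.2.1).eq_or_lt with h0 | h0
  · have : x = 0 := Subtype.ext h0.symm
    subst this
    rw [apply_zero_of_mem_muntzPolynomials hΛ hp]
    simp [Real.zero_rpow (hΛ 0).ne']
  have hpi : Integrable fun t : I => ‖p t‖ :=
    unitInterval.integrable_of_continuous (continuous_of_mem_muntzPolynomials hΛ hp).norm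
  set s : Set I := Icc ⟨r / 2, by constructor <;> linarith⟩ ⟨r, hr.le, hr1.le⟩ with hs
  have hvs : volume s = ENNReal.ofReal (r / 2) := by
    rw [hs, unitInterval.volume_Icc]
    congr 1
    simp only
    ring
  -- Some point of `[r/2, r]` has `‖p y‖` at most the average over this interval; the Hölder bound
  -- transports this value to every `x` in `(0, r]`.
  obtain ⟨y, hy, hyle⟩ := exists_le_setAverage (μ := volume) (s := s) (f := fun t => ‖p t‖)
    (by rw [hvs]; simpa using hr) (by rw [hvs]; exact ENNReal.ofReal_ne_top) hpi.integrableOn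
  have hy1 : r / 2 ≤ (y : ℝ) := hy.1
  have hy2 : (y : ℝ) ≤ r := hy.2
  have hy0 : 0 < (y : ℝ) := by linarith
  rw [setAverage_eq, Measure.real, hvs, ENNReal.toReal_ofReal (by positivity), smul_eq_mul] at hyle
  have hyA : ‖p y‖ ≤ 2 / r * A := by
    refine hyle.trans ?_
    rw [inv_div]
    gcongr
    exact setIntegral_le_integral hpi (Eventually.of_forall fun _ => norm_nonneg _)
  have hpow1 : ∀ t : I, |(t : ℝ) ^ β - (y : ℝ) ^ β| ≤ 1 := by
    intro t
    have a1 := Real.rpow_nonneg t.2.1 β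
    have a2 := Real.rpow_nonneg y.2.1 β
    have a3 := Real.rpow_le_one t.2.1 t.2.2 hβ.le
    have a4 := Real.rpow_le_one y.2.1 y.2.2 hβ.le
    exact abs_le.2 ⟨by linarith, by linarith⟩
  have hk := h p hp x ⟨h0, hx⟩ y ⟨hy0, hy2⟩
  have hx' : ‖((x : ℝ) ^ (-Λ 0)) • p x‖ ≤ ((r / 2) ^ (-Λ 0) * (2 / r) + C) * A := by
    have h1 := norm_sub_norm_le (((x : ℝ) ^ (-Λ 0)) • p x) (((y : ℝ) ^ (-Λ 0)) • p y)
    have h2 : ‖((y : ℝ) ^ (-Λ 0)) • p y‖ ≤ (r / 2) ^ (-Λ 0) * (2 / r * A) := by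
      rw [norm_smul, Real.norm_of_nonneg (Real.rpow_nonneg hy0.le _)]
      have : (y : ℝ) ^ (-Λ 0) ≤ (r / 2) ^ (-Λ 0) :=
        Real.rpow_le_rpow_of_nonpos (by linarith) hy1 (neg_nonpos.2 (hΛ 0).le)
      gcongr
    have h3 : C * A * |(x : ℝ) ^ β - (y : ℝ) ^ β| ≤ C * A :=
      mul_le_of_le_one_right (by positivity) (hpow1 x)
    linarith
  rw [norm_smul, Real.norm_of_nonneg (Real.rpow_nonneg h0.le _), Real.rpow_neg h0.le,
    inv_mul_le_iff₀ (Real.rpow_pos_of_pos h0 _)] at hx'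
  linarith

/-! ### Continuous versions of the elements of the Müntz space -/

/-- Needed to turn almost everywhere equality of functions continuous on `[0, 1)` into equality
there. -/
instance unitInterval.isOpenPosMeasure_volume : (volume : Measure I).IsOpenPosMeasure where
  open_pos U hU hne h0 := by
    obtain ⟨a, b, hab, hsub⟩ := hU.exists_Ioo_subset hne
    have h1 : volume (Ioo a b) = 0 := measure_mono_null hsub h0
    rw [unitInterval.volume_Ioo, ENNReal.ofReal_eq_zero] at h1
    have : (a : ℝ) < b := hab
    linarith

theorem memLp_of_mem_muntzPolynomials (hΛ : ∀ n, 0 < Λ n) {p : I → 𝕜}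
    (hp : p ∈ muntzPolynomials 𝕜 Λ) : MemLp p 1 (volume : Measure I) :=
  memLp_one_iff_integrable.2
    (unitInterval.integrable_of_continuous (continuous_of_mem_muntzPolynomials hΛ hp))

theorem exists_mem_muntzPolynomials_of_mem_span {f : Lp 𝕜 1 (volume : Measure I)}
    (hf : f ∈ Submodule.span 𝕜 {f : Lp 𝕜 1 (volume : Measure I) |
      ∃ n, (f : I → 𝕜) =ᵐ[volume] muntzMonomial 𝕜 (Λ n)}) :
    ∃ p ∈ muntzPolynomials 𝕜 Λ, (f : I → 𝕜) =ᵐ[volume] p := by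
  induction hf using Submodule.span_induction with
  | mem f h =>
    obtain ⟨n, hn⟩ := h
    exact ⟨_, Submodule.subset_span ⟨n, rfl⟩, hn⟩
  | zero => exact ⟨0, zero_mem _, Lp.coeFn_zero _ _ _⟩
  | add f g _ _ hf hg =>
    obtain ⟨p, hp, hfp⟩ := hf
    obtain ⟨q, hq, hgq⟩ := hg
    exact ⟨p + q, add_mem hp hq, (Lp.coeFn_add f g).trans (hfp.add hgq)⟩
  | smul c f _ hf =>
    obtain ⟨p, hp, hfp⟩ := hf
    exact ⟨c • p, Submodule.smul_mem _ c hp, (Lp.coeFn_smul c f).trans (hfp.const_smul c)⟩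

theorem mem_muntzSpace_of_ae_eq (hΛ : ∀ n, 0 < Λ n) {p : I → 𝕜} (hp : p ∈ muntzPolynomials 𝕜 Λ)
    {f : Lp 𝕜 1 (volume : Measure I)} (hfp : (f : I → 𝕜) =ᵐ[volume] p) :
    f ∈ muntzSpace 𝕜 Λ := by
  refine Submodule.le_topologicalClosure _ ?_
  have : ∃ g ∈ Submodule.span 𝕜 {f : Lp 𝕜 1 (volume : Measure I) |
      ∃ n, (f : I → 𝕜) =ᵐ[volume] muntzMonomial 𝕜 (Λ n)}, (g : I → 𝕜) =ᵐ[volume] p := by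
    clear hfp f
    induction hp using Submodule.span_induction with
    | mem p h =>
      obtain ⟨n, rfl⟩ := h
      have h1 : MemLp (muntzMonomial 𝕜 (Λ n)) 1 (volume : Measure I) :=
        memLp_of_mem_muntzPolynomials hΛ (Submodule.subset_span ⟨n, rfl⟩)
      exact ⟨h1.toLp _, Submodule.subset_span ⟨n, h1.coeFn_toLp⟩, h1.coeFn_toLp⟩
    | zero => exact ⟨0, zero_mem _, Lp.coeFn_zero _ _ _⟩
    | add p q _ _ hf hg =>
      obtain ⟨f, hf, hfp⟩ := hf
      obtain ⟨g, hg, hgq⟩ := hg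
      exact ⟨f + g, add_mem hf hg, (Lp.coeFn_add f g).trans (hfp.add hgq)⟩
    | smul c p _ hf =>
      obtain ⟨f, hf, hfp⟩ := hf
      exact ⟨c • f, Submodule.smul_mem _ c hf, (Lp.coeFn_smul c f).trans (hfp.const_smul c)⟩
  obtain ⟨g, hg, hgp⟩ := this
  rwa [Lp.ext (hfp.trans hgp.symm)]

theorem integral_norm_eq_of_ae_eq {f : Lp 𝕜 1 (volume : Measure I)} {p : I → 𝕜}
    (hfp : (f : I → 𝕜) =ᵐ[volume] p) : ∫ t : I, ‖p t‖ = ‖f‖ := by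
  rw [L1.norm_eq_integral_norm]
  exact integral_congr_ae (hfp.symm.fun_comp norm)

theorem eqOn_of_ae_eq_of_continuousOn {f g : I → 𝕜} (h : f =ᵐ[volume] g)
    (hf : ContinuousOn f (Iio 1)) (hg : ContinuousOn g (Iio 1)) : EqOn f g (Iio 1) :=
  Measure.eqOn_open_of_ae_eq (ae_restrict_of_ae h) isOpen_Iio hf hg

/-- Every element of a Müntz space has a version that is a locally uniform limit of Müntz
polynomials on `[0,1)`. -/
theorem exists_tendsto_of_mem_muntzSpace (hΛ : ∀ n, 0 < Λ n) (hmono : StrictMono Λ)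
    (hsum : Summable fun n => 1 / Λ n) {f : Lp 𝕜 1 (volume : Measure I)}
    (hf : f ∈ muntzSpace 𝕜 Λ) :
    ∃ (p : ℕ → I → 𝕜) (g : I → 𝕜), (∀ k, p k ∈ muntzPolynomials 𝕜 Λ) ∧
      Tendsto (fun k => ∫ t : I, ‖p k t‖) atTop (𝓝 ‖f‖) ∧
      (∀ x < 1, Tendsto (fun k => p k x) atTop (𝓝 (g x))) ∧
      ContinuousOn g (Iio 1) ∧ (f : I → 𝕜) =ᵐ[volume] g := by
  obtain ⟨F, hF, hFlim⟩ := mem_closure_iff_seq_limit.1 hf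
  choose p hp hFp using fun k => exists_mem_muntzPolynomials_of_mem_span (hF k)
  -- The pointwise bound, applied to differences, turns `L¹` convergence into uniform convergence on
  -- `[0, r]`.
  have hcauchy : ∀ r : ℝ, 0 < r → r < 1 → UniformCauchySeqOn p atTop {x : I | (x : ℝ) ≤ r} := by
    intro r hr hr1
    obtain ⟨C, hC, hbd⟩ := exists_muntzPolynomials_bound 𝕜 hΛ hmono hsum hr hr1
    rw [Metric.uniformCauchySeqOn_iff]
    intro ε hε
    obtain ⟨N, hN⟩ := Metric.cauchySeq_iff.1 hFlim.cauchySeq (ε / C) (by positivity)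
    refine ⟨N, fun m hm n hn x hx => ?_⟩
    have h1 := hbd (p m - p n) (sub_mem (hp m) (hp n)) x hx
    have h2 : ∫ t : I, ‖(p m - p n) t‖ = dist (F m) (F n) := by
      rw [dist_eq_norm]
      exact integral_norm_eq_of_ae_eq ((Lp.coeFn_sub _ _).trans ((hFp m).sub (hFp n)))
    rw [h2, Pi.sub_apply, ← dist_eq_norm] at h1
    refine h1.trans_lt ?_
    have h3 : (x : ℝ) ^ Λ 0 ≤ 1 := Real.rpow_le_one x.2.1 x.2.2 (hΛ 0).le
    calc C * (x : ℝ) ^ Λ 0 * dist (F m) (F n) ≤ C * 1 * dist (F m) (F n) := by gcongr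
      _ < C * 1 * (ε / C) := by
        gcongr
        exact hN m hm n hn
      _ = ε := by field_simp
  have hr : ∀ x : I, x < 1 → ∃ r : ℝ, 0 < r ∧ r < 1 ∧ (x : ℝ) < r := by
    intro x hx
    have hx' : (x : ℝ) < 1 := hx
    have := x.2.1
    exact ⟨((x : ℝ) + 1) / 2, by linarith, by linarith, by linarith⟩
  have hlim : ∀ x : I, ∃ l, x < 1 → Tendsto (fun k => p k x) atTop (𝓝 l) := by
    intro x
    by_cases hx : x < 1
    · obtain ⟨r, hr, hr1, hxr⟩ := hr x hx
      obtain ⟨l, hl⟩ := cauchySeq_tendsto_of_complete ((hcauchy r hr hr1).cauchySeq hxr.le)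
      exact ⟨l, fun _ => hl⟩
    · exact ⟨0, fun h => absurd h hx⟩
  choose g hg using hlim
  refine ⟨p, g, hp, ?_, hg, ?_, ?_⟩
  · simp_rw [fun k => integral_norm_eq_of_ae_eq (hFp k)]
    exact hFlim.norm
  · intro x hx
    obtain ⟨r, hr, hr1, hxr⟩ := hr x hx
    have hu : TendstoUniformlyOn p g atTop {x : I | (x : ℝ) ≤ r} :=
      (hcauchy r hr hr1).tendstoUniformlyOn_of_tendsto fun y hy =>
        hg y (show (y : ℝ) < 1 from lt_of_le_of_lt hy hr1)
    have hc := hu.continuousOn (Frequently.of_forall fun k =>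
      (continuous_of_mem_muntzPolynomials hΛ (hp k)).continuousOn)
    refine (hc.continuousAt ?_).continuousWithinAt
    exact mem_of_superset ((isOpen_lt continuous_subtype_val continuous_const).mem_nhds hxr)
      fun y hy => le_of_lt (show (y : ℝ) < r from hy)
  · obtain ⟨ns, hns, hae⟩ := (tendstoInMeasure_of_tendsto_Lp hFlim).exists_seq_tendsto_ae
    filter_upwards [hae, ae_all_iff.2 hFp, Measure.ae_ne volume (1 : I)] with x h1 h2 h3
    simp_rw [h2] at h1
    exact tendsto_nhds_unique h1
      ((hg x (lt_of_le_of_ne x.2.2 h3)).comp hns.tendsto_atTop)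

/-- Shows that the default branch of `muntzFun` is never taken on the Müntz space. If the locally
uniform limit extends to `1`, its value there is corrected. -/
theorem isContinuousVersion_muntzFun (hΛ : ∀ n, 0 < Λ n) (hmono : StrictMono Λ)
    (hsum : Summable fun n => 1 / Λ n) {f : Lp 𝕜 1 (volume : Measure I)}
    (hf : f ∈ muntzSpace 𝕜 Λ) : IsContinuousVersion f (muntzFun f) := by
  have h : ∃ g, IsContinuousVersion f g := by
    obtain ⟨-, g, -, -, -, hg, hfg⟩ := exists_tendsto_of_mem_muntzSpace hΛ hmono hsum hf
    by_cases hl : ∃ l : 𝕜, Tendsto g (𝓝[<] 1) (𝓝 l)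
    · classical
      obtain ⟨l, hl⟩ := hl
      have heq : EqOn (Function.update g 1 l) g (Iio 1) := fun x hx =>
        Function.update_of_ne (ne_of_lt hx) _ _
      refine ⟨Function.update g 1 l, ?_, hg.congr heq, fun _ => ?_⟩
      · refine hfg.trans ?_
        filter_upwards [Measure.ae_ne volume (1 : I)] with x hx
        exact (Function.update_of_ne hx _ _).symm
      · rw [continuousAt_update_same]
        have : ({1}ᶜ : Set I) = Iio 1 := by
          ext x
          exact ⟨fun hx => lt_of_le_of_ne (show x ≤ 1 from x.2.2) hx, fun hx => ne_of_lt hx⟩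
        rwa [this]
    · exact ⟨g, hfg, hg, fun h => absurd h hl⟩
  rw [muntzFun, dif_pos h]
  exact h.choose_spec

/-- Equality is claimed only on `[0, 1)`: when there is no limit at `1`, the value there is
arbitrary. -/
theorem muntzFun_eqOn (hΛ : ∀ n, 0 < Λ n) (hmono : StrictMono Λ)
    (hsum : Summable fun n => 1 / Λ n) {f : Lp 𝕜 1 (volume : Measure I)}
    (hf : f ∈ muntzSpace 𝕜 Λ) {g : I → 𝕜} (hfg : (f : I → 𝕜) =ᵐ[volume] g)
    (hg : ContinuousOn g (Iio 1)) : EqOn (muntzFun f) g (Iio 1) := by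
  obtain ⟨h1, h2, -⟩ := isContinuousVersion_muntzFun hΛ hmono hsum hf
  exact eqOn_of_ae_eq_of_continuousOn (h1.symm.trans hfg) h2 hg

/-- Here the continuity clause at `1` determines the value there. The point `1` matters as long as
`μ {1} = 0` is not known. -/
theorem muntzFun_eq_of_mem_muntzPolynomials (hΛ : ∀ n, 0 < Λ n) (hmono : StrictMono Λ)
    (hsum : Summable fun n => 1 / Λ n) {f : Lp 𝕜 1 (volume : Measure I)} {p : I → 𝕜}
    (hp : p ∈ muntzPolynomials 𝕜 Λ) (hfp : (f : I → 𝕜) =ᵐ[volume] p) : muntzFun f = p := by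
  have hf := mem_muntzSpace_of_ae_eq hΛ hp hfp
  have hpc := continuous_of_mem_muntzPolynomials hΛ hp
  have heq := muntzFun_eqOn hΛ hmono hsum hf hfp hpc.continuousOn
  obtain ⟨-, -, h3⟩ := isContinuousVersion_muntzFun hΛ hmono hsum hf
  have hlim : Tendsto (muntzFun f) (𝓝[<] 1) (𝓝 (p 1)) :=
    (hpc.continuousAt.tendsto.mono_left nhdsWithin_le_nhds).congr'
      (heq.symm.eventuallyEq_of_mem self_mem_nhdsWithin)
  ext x
  rcases (show x ≤ 1 from x.2.2).lt_or_eq with hx | rfl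
  · exact heq hx
  · have : (𝓝[<] (1 : I)).NeBot := nhdsLT_neBot_of_exists_lt ⟨0, zero_lt_one⟩
    exact tendsto_nhds_unique ((h3 ⟨_, hlim⟩).tendsto.mono_left nhdsWithin_le_nhds) hlim

theorem exists_tendsto_muntzFun (hΛ : ∀ n, 0 < Λ n) (hmono : StrictMono Λ)
    (hsum : Summable fun n => 1 / Λ n) {f : Lp 𝕜 1 (volume : Measure I)}
    (hf : f ∈ muntzSpace 𝕜 Λ) :
    ∃ p : ℕ → I → 𝕜, (∀ k, p k ∈ muntzPolynomials 𝕜 Λ) ∧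
      Tendsto (fun k => ∫ t : I, ‖p k t‖) atTop (𝓝 ‖f‖) ∧
      ∀ x < 1, Tendsto (fun k => p k x) atTop (𝓝 (muntzFun f x)) := by
  obtain ⟨p, g, hp, hlim, hpg, hg, hfg⟩ := exists_tendsto_of_mem_muntzSpace hΛ hmono hsum hf
  refine ⟨p, hp, hlim, fun x hx => ?_⟩
  rw [muntzFun_eqOn hΛ hmono hsum hf hfg hg hx]
  exact hpg x hx

theorem muntzFun_add (hΛ : ∀ n, 0 < Λ n) (hmono : StrictMono Λ)
    (hsum : Summable fun n => 1 / Λ n) {f g : Lp 𝕜 1 (volume : Measure I)}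
    (hf : f ∈ muntzSpace 𝕜 Λ) (hg : g ∈ muntzSpace 𝕜 Λ) :
    EqOn (muntzFun (f + g)) (muntzFun f + muntzFun g) (Iio 1) := by
  obtain ⟨f1, f2, -⟩ := isContinuousVersion_muntzFun hΛ hmono hsum hf
  obtain ⟨g1, g2, -⟩ := isContinuousVersion_muntzFun hΛ hmono hsum hg
  exact muntzFun_eqOn hΛ hmono hsum (add_mem hf hg) ((Lp.coeFn_add _ _).trans (f1.add g1))
    (f2.add g2)

theorem muntzFun_smul (hΛ : ∀ n, 0 < Λ n) (hmono : StrictMono Λ)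
    (hsum : Summable fun n => 1 / Λ n) (c : 𝕜) {f : Lp 𝕜 1 (volume : Measure I)}
    (hf : f ∈ muntzSpace 𝕜 Λ) :
    EqOn (muntzFun (c • f)) (c • muntzFun f) (Iio 1) := by
  obtain ⟨f1, f2, -⟩ := isContinuousVersion_muntzFun hΛ hmono hsum hf
  exact muntzFun_eqOn hΛ hmono hsum (Submodule.smul_mem _ c hf)
    ((Lp.coeFn_smul _ _).trans (f1.const_smul c)) (f2.const_smul c)

theorem measurable_muntzFun (hΛ : ∀ n, 0 < Λ n) (hmono : StrictMono Λ)
    (hsum : Summable fun n => 1 / Λ n) {f : Lp 𝕜 1 (volume : Measure I)}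
    (hf : f ∈ muntzSpace 𝕜 Λ) : Measurable (muntzFun f) := by
  obtain ⟨-, h2, -⟩ := isContinuousVersion_muntzFun hΛ hmono hsum hf
  refine measurable_of_restrict_of_restrict_compl (s := Iio 1) measurableSet_Iio
    (continuousOn_iff_continuous_domRestrict.1 h2).measurable ?_
  have : Subsingleton ((Iio (1 : I))ᶜ : Set I) := by
    refine ⟨fun x y => Subtype.ext ?_⟩
    have hx : (x : I) = 1 := le_antisymm (x : I).2.2 (not_lt.1 x.2)
    have hy : (y : I) = 1 := le_antisymm (y : I).2.2 (not_lt.1 y.2)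
    rw [hx, hy]
  exact Subsingleton.measurable

theorem exists_muntzFun_holder_bound (𝕜 : Type*) [RCLike 𝕜] (hΛ : ∀ n, 0 < Λ n)
    (hmono : StrictMono Λ) (hsum : Summable fun n => 1 / Λ n)
    {r : ℝ} (hr : 0 < r) (hr1 : r < 1) :
    ∃ β C : ℝ, 0 < β ∧ 0 < C ∧ ∀ f ∈ muntzSpace 𝕜 Λ,
      ∀ x : I, (x : ℝ) ∈ Ioc 0 r → ∀ y : I, (y : ℝ) ∈ Ioc 0 r →
        ‖((x : ℝ) ^ (-Λ 0)) • muntzFun f x - ((y : ℝ) ^ (-Λ 0)) • muntzFun f y‖ ≤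
          C * ‖f‖ * |(x : ℝ) ^ β - (y : ℝ) ^ β| := by
  obtain ⟨β, C, hβ, hC, h⟩ := exists_muntzPolynomials_holder_bound 𝕜 hΛ hmono hsum hr hr1
  refine ⟨β, C, hβ, hC, fun f hf x hx y hy => ?_⟩
  obtain ⟨p, hp, hlim, hpt⟩ := exists_tendsto_muntzFun hΛ hmono hsum hf
  refine le_of_tendsto_of_tendsto'
    (((hpt x (show (x : ℝ) < 1 from hx.2.trans_lt hr1)).const_smul _).sub
      ((hpt y (show (y : ℝ) < 1 from hy.2.trans_lt hr1)).const_smul _)).norm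
    ((hlim.const_mul C).mul_const _) fun k => h (p k) (hp k) x hx y hy

theorem exists_muntzFun_bound (𝕜 : Type*) [RCLike 𝕜] (hΛ : ∀ n, 0 < Λ n)
    (hmono : StrictMono Λ) (hsum : Summable fun n => 1 / Λ n)
    {r : ℝ} (hr : 0 < r) (hr1 : r < 1) :
    ∃ C : ℝ, 0 < C ∧ ∀ f ∈ muntzSpace 𝕜 Λ, ∀ x : I, (x : ℝ) ≤ r →
        ‖muntzFun f x‖ ≤ C * (x : ℝ) ^ Λ 0 * ‖f‖ := by
  obtain ⟨C, hC, h⟩ := exists_muntzPolynomials_bound 𝕜 hΛ hmono hsum hr hr1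
  refine ⟨C, hC, fun f hf x hx => ?_⟩
  obtain ⟨p, hp, hlim, hpt⟩ := exists_tendsto_muntzFun hΛ hmono hsum hf
  exact le_of_tendsto_of_tendsto' (hpt x (show (x : ℝ) < 1 from hx.trans_lt hr1)).norm
    (hlim.const_mul _) fun k => h (p k) (hp k) x hx

/-! ### Embedding measures and the embedding operator -/

theorem eLpNorm_one_eq_ofReal_integral_norm {p : I → 𝕜} (hp : MemLp p 1 (volume : Measure I)) :
    eLpNorm p 1 (volume : Measure I) = ENNReal.ofReal (∫ t : I, ‖p t‖) := by
  rw [ofReal_integral_norm_eq_lintegral_enorm (memLp_one_iff_integrable.1 hp),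
    eLpNorm_one_eq_lintegral_enorm]

theorem integral_norm_muntzMonomial {a : ℝ} (ha : 0 < a) :
    ∫ x : I, ‖muntzMonomial 𝕜 a x‖ = 1 / (a + 1) := by
  have : ∀ x : I, ‖muntzMonomial 𝕜 a x‖ = (x : ℝ) ^ a := fun x => by
    rw [muntzMonomial, RCLike.norm_ofReal, abs_of_nonneg (Real.rpow_nonneg x.2.1 _)]
  simp_rw [this]
  rw [unitInterval.measurePreserving_coe.integral_comp unitInterval.measurableEmbedding_coe
    (fun x : ℝ => x ^ a), integral_Icc_eq_integral_Ioc,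
    ← intervalIntegral.integral_of_le zero_le_one, integral_rpow (Or.inl (by linarith))]
  simp [Real.zero_rpow (by linarith : a + 1 ≠ 0)]

/-- Every monomial equals `1` at `1`, while its `L¹` norm `1/(λₙ + 1)` tends to `0`. Afterwards the
undetermined values at `1` are harmless. -/
theorem IsMuntzEmbedding.measure_singleton_one (hΛ : ∀ n, 0 < Λ n)
    (hsum : Summable fun n => 1 / Λ n) {μ : Measure I} (h : IsMuntzEmbedding 𝕜 Λ μ) :
    μ {1} = 0 := by
  obtain ⟨C, -, hC⟩ := h
  have hle : ∀ n, μ {1} ≤ C * ENNReal.ofReal (1 / Λ n) := by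
    intro n
    have hp : muntzMonomial 𝕜 (Λ n) ∈ muntzPolynomials 𝕜 Λ := Submodule.subset_span ⟨n, rfl⟩
    have h1 := hC _ hp
    rw [eLpNorm_one_eq_ofReal_integral_norm (memLp_of_mem_muntzPolynomials hΛ hp),
      integral_norm_muntzMonomial (hΛ n), eLpNorm_one_eq_lintegral_enorm] at h1
    calc μ {1} = ∫⁻ _ in {(1 : I)}, 1 ∂μ := by simp
      _ = ∫⁻ x in {(1 : I)}, ‖muntzMonomial 𝕜 (Λ n) x‖ₑ ∂μ := by
        refine setLIntegral_congr_fun (measurableSet_singleton _) ?_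
        rintro x rfl
        simp [muntzMonomial]
      _ ≤ ∫⁻ x, ‖muntzMonomial 𝕜 (Λ n) x‖ₑ ∂μ := setLIntegral_le_lintegral _ _
      _ ≤ _ := h1
      _ ≤ _ := by
        have := hΛ n
        gcongr
        linarith
  have hlim : Tendsto (fun n => C * ENNReal.ofReal (1 / Λ n)) atTop (𝓝 0) := by
    have := ENNReal.Tendsto.const_mul (a := (C : ℝ≥0∞))
      ((ENNReal.continuous_ofReal.tendsto 0).comp hsum.tendsto_atTop_zero)
      (Or.inr ENNReal.coe_ne_top)
    simpa using this
  exact le_antisymm (ge_of_tendsto' hlim hle) (zero_le)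

/-- Fatou's lemma along polynomials that converge on `[0, 1)`, hence `μ`-almost everywhere. -/
theorem lintegral_muntzFun_le (hΛ : ∀ n, 0 < Λ n) (hmono : StrictMono Λ)
    (hsum : Summable fun n => 1 / Λ n) {μ : Measure I} {C : ℝ≥0}
    (hC : ∀ p ∈ muntzPolynomials 𝕜 Λ, eLpNorm p 1 μ ≤ C * eLpNorm p 1 (volume : Measure I))
    (hμ : μ {1} = 0) {f : Lp 𝕜 1 (volume : Measure I)} (hf : f ∈ muntzSpace 𝕜 Λ) :
    ∫⁻ x, ‖muntzFun f x‖ₑ ∂μ ≤ C * ENNReal.ofReal ‖f‖ := by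
  obtain ⟨p, hp, hlim, hpt⟩ := exists_tendsto_muntzFun hΛ hmono hsum hf
  have hae : ∀ᵐ x ∂μ, x ≠ 1 := by
    rw [ae_iff]
    simpa using hμ
  have h1 : ∀ᵐ x ∂μ, ‖muntzFun f x‖ₑ = liminf (fun k => ‖p k x‖ₑ) atTop := by
    filter_upwards [hae] with x hx
    exact (hpt x (lt_of_le_of_ne x.2.2 hx)).enorm.liminf_eq.symm
  rw [lintegral_congr_ae h1]
  refine (lintegral_liminf_le fun k =>
    (continuous_of_mem_muntzPolynomials hΛ (hp k)).measurable.enorm).trans ?_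
  have h2 : Tendsto (fun k => C * ENNReal.ofReal (∫ t : I, ‖p k t‖)) atTop
      (𝓝 (C * ENNReal.ofReal ‖f‖)) :=
    ENNReal.Tendsto.const_mul ((ENNReal.continuous_ofReal.tendsto _).comp hlim)
      (Or.inr ENNReal.coe_ne_top)
  rw [← h2.liminf_eq]
  refine liminf_le_liminf (Eventually.of_forall fun k => ?_)
  have := hC _ (hp k)
  rwa [eLpNorm_one_eq_ofReal_integral_norm (memLp_of_mem_muntzPolynomials hΛ (hp k)),
    eLpNorm_one_eq_lintegral_enorm] at this

/-- `muntzFun` is known to be linear only on `[0, 1)`; as `μ {1} = 0`, this suffices in `L¹(μ)`. -/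
theorem IsMuntzEmbedding.exists_isEmbeddingOperator (hΛ : ∀ n, 0 < Λ n) (hmono : StrictMono Λ)
    (hsum : Summable fun n => 1 / Λ n) {μ : Measure I} (h : IsMuntzEmbedding 𝕜 Λ μ) :
    ∃ S : muntzSpace 𝕜 Λ →L[𝕜] Lp 𝕜 1 μ, IsEmbeddingOperator μ S := by
  have hμ := h.measure_singleton_one hΛ hsum
  have hae : ∀ᵐ x ∂μ, x < 1 := by
    have : ∀ᵐ x ∂μ, x ≠ 1 := by
      rw [ae_iff]
      simpa using hμ
    filter_upwards [this] with x hx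
    exact lt_of_le_of_ne x.2.2 hx
  obtain ⟨C, -, hC⟩ := h
  have hmem : ∀ f : muntzSpace 𝕜 Λ, MemLp (muntzFun (f : Lp 𝕜 1 (volume : Measure I))) 1 μ := by
    intro f
    refine ⟨(measurable_muntzFun hΛ hmono hsum f.2).aestronglyMeasurable, ?_⟩
    rw [eLpNorm_one_eq_lintegral_enorm]
    exact (lintegral_muntzFun_le hΛ hmono hsum hC hμ f.2).trans_lt
      (ENNReal.mul_lt_top ENNReal.coe_lt_top ENNReal.ofReal_lt_top)
  refine ⟨LinearMap.mkContinuous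
    { toFun := fun f => (hmem f).toLp _
      map_add' := fun f g => ?_
      map_smul' := fun c f => ?_ } C fun f => ?_, fun f => (hmem f).coeFn_toLp⟩
  · rw [← MemLp.toLp_add, MemLp.toLp_eq_toLp_iff]
    filter_upwards [hae] with x hx using muntzFun_add hΛ hmono hsum f.2 g.2 hx
  · rw [← MemLp.toLp_const_smul, MemLp.toLp_eq_toLp_iff]
    filter_upwards [hae] with x hx using muntzFun_smul hΛ hmono hsum c f.2 hx
  · change ‖(hmem f).toLp _‖ ≤ C * ‖f‖
    rw [Lp.norm_toLp, eLpNorm_one_eq_lintegral_enorm]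
    refine ENNReal.toReal_le_of_le_ofReal (by positivity) ?_
    rw [ENNReal.ofReal_mul (by positivity), ENNReal.ofReal_coe_nnreal]
    exact lintegral_muntzFun_le hΛ hmono hsum hC hμ f.2

/-! ### The isometry between the two operators -/

theorem lintegral_weightedPullback {φ : I → I} (hφ : Measurable φ) {ψ : I → 𝕜} (hψ : Measurable ψ)
    {g : I → ℝ≥0∞} (hg : Measurable g) :
    ∫⁻ x, g x ∂(weightedPullback φ ψ) = ∫⁻ x, ‖ψ x‖ₑ * g (φ x) := by
  rw [weightedPullback, lintegral_map hg hφ]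
  exact lintegral_withDensity_eq_lintegral_mul _ hψ.enorm (hg.comp hφ)

theorem setLIntegral_weightedPullback {φ : I → I} (hφ : Measurable φ) {ψ : I → 𝕜}
    (hψ : Measurable ψ) {g : I → 𝕜} (hg : Measurable g) {s : Set I} (hs : MeasurableSet s) :
    ∫⁻ x in s, ‖g x‖ₑ ∂(weightedPullback φ ψ) = ∫⁻ x in φ ⁻¹' s, ‖ψ x * g (φ x)‖ₑ := by
  rw [← lintegral_indicator hs, lintegral_weightedPullback hφ hψ (hg.enorm.indicator hs),
    ← lintegral_indicator (hφ hs)]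
  congr 1
  ext x
  by_cases hx : φ x ∈ s <;> simp [indicator, hx, enorm_mul]

/-- Preimages of `μ`-null sets are Lebesgue null where `ψ ≠ 0`; where `ψ = 0` both sides vanish. -/
theorem ae_mul_comp_of_ae_weightedPullback {φ : I → I} (hφ : Measurable φ) {ψ : I → 𝕜}
    (hψ : Measurable ψ) {g g' : I → 𝕜} (h : g =ᵐ[weightedPullback φ ψ] g') :
    (fun x => ψ x * g (φ x)) =ᵐ[volume] fun x => ψ x * g' (φ x) := by
  have h1 := (ae_withDensity_iff hψ.enorm).1 (ae_of_ae_map hφ.aemeasurable h)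
  filter_upwards [h1] with x hx
  by_cases h0 : ψ x = 0
  · simp [h0]
  · rw [hx (by simpa using h0)]

/-- The isometry `g ↦ ψ · (g ∘ φ)` of `L¹(μ)` into `L¹`. -/
theorem exists_weightedComp_linearIsometry {φ : I → I} (hφ : Measurable φ) {ψ : I → 𝕜}
    (hψ : Measurable ψ) :
    ∃ J : Lp 𝕜 1 (weightedPullback φ ψ) →ₗᵢ[𝕜] Lp 𝕜 1 (volume : Measure I),
      ∀ g, (J g : I → 𝕜) =ᵐ[volume] fun x => ψ x * g (φ x) := by
  have hnorm : ∀ g : Lp 𝕜 1 (weightedPullback φ ψ),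
      eLpNorm (fun x => ψ x * g (φ x)) 1 (volume : Measure I) =
        eLpNorm g 1 (weightedPullback φ ψ) := by
    intro g
    have := setLIntegral_weightedPullback hφ hψ (Lp.stronglyMeasurable g).measurable
      MeasurableSet.univ
    simp only [preimage_univ, Measure.restrict_univ] at this
    rw [eLpNorm_one_eq_lintegral_enorm, eLpNorm_one_eq_lintegral_enorm, this]
  have hmem : ∀ g : Lp 𝕜 1 (weightedPullback φ ψ),
      MemLp (fun x => ψ x * g (φ x)) 1 (volume : Measure I) := by
    intro g
    refine ⟨(hψ.mul ((Lp.stronglyMeasurable g).measurable.comp hφ)).aestronglyMeasurable, ?_⟩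
    rw [hnorm g]
    exact Lp.eLpNorm_lt_top g
  refine ⟨
    { toFun := fun g => (hmem g).toLp _
      map_add' := fun g g' => ?_
      map_smul' := fun c g => ?_
      norm_map' := fun g => ?_ }, fun g => (hmem g).coeFn_toLp⟩
  · rw [← MemLp.toLp_add, MemLp.toLp_eq_toLp_iff]
    refine (ae_mul_comp_of_ae_weightedPullback hφ hψ (Lp.coeFn_add g g')).trans
      (Eventually.of_forall fun x => ?_)
    simp [mul_add]
  · rw [RingHom.id_apply, ← MemLp.toLp_const_smul, MemLp.toLp_eq_toLp_iff]
    refine (ae_mul_comp_of_ae_weightedPullback hφ hψ (Lp.coeFn_smul c g)).trans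
      (Eventually.of_forall fun x => ?_)
    simp [mul_left_comm]
  · change ‖(hmem g).toLp _‖ = ‖g‖
    rw [Lp.norm_toLp, hnorm g, Lp.norm_def]

theorem IsEmbeddingOperator.isMuntzEmbedding (hΛ : ∀ n, 0 < Λ n) (hmono : StrictMono Λ)
    (hsum : Summable fun n => 1 / Λ n) {μ : Measure I} {S : muntzSpace 𝕜 Λ →L[𝕜] Lp 𝕜 1 μ}
    (hS : IsEmbeddingOperator μ S) : IsMuntzEmbedding 𝕜 Λ μ := by
  -- The summand `1` keeps the constant positive when `S = 0`.
  refine ⟨‖S‖₊ + 1, by positivity, fun p hp => ?_⟩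
  have hp1 := memLp_of_mem_muntzPolynomials hΛ hp
  let f : muntzSpace 𝕜 Λ := ⟨hp1.toLp p, mem_muntzSpace_of_ae_eq hΛ hp hp1.coeFn_toLp⟩
  have h1 : (S f : I → 𝕜) =ᵐ[μ] p := by
    have := hS f
    rwa [muntzFun_eq_of_mem_muntzPolynomials hΛ hmono hsum hp hp1.coeFn_toLp] at this
  have h2 : ‖f‖ₑ = eLpNorm p 1 (volume : Measure I) := Lp.enorm_toLp hp1
  rw [← eLpNorm_congr_ae h1, ← Lp.enorm_def, ← h2]
  refine (S.le_opENorm f).trans ?_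
  gcongr
  rw [enorm_eq_nnnorm]
  exact_mod_cast le_self_add

theorem IsWeightedCompOperator.isMuntzEmbedding (hΛ : ∀ n, 0 < Λ n) (hmono : StrictMono Λ)
    (hsum : Summable fun n => 1 / Λ n) {φ : I → I} (hφ : Measurable φ) {ψ : I → 𝕜}
    (hψ : Measurable ψ) {T : muntzSpace 𝕜 Λ →L[𝕜] Lp 𝕜 1 (volume : Measure I)}
    (hT : IsWeightedCompOperator φ ψ T) : IsMuntzEmbedding 𝕜 Λ (weightedPullback φ ψ) := by
  refine ⟨‖T‖₊ + 1, by positivity, fun p hp => ?_⟩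
  have hp1 := memLp_of_mem_muntzPolynomials hΛ hp
  let f : muntzSpace 𝕜 Λ := ⟨hp1.toLp p, mem_muntzSpace_of_ae_eq hΛ hp hp1.coeFn_toLp⟩
  have h1 : (T f : I → 𝕜) =ᵐ[volume] fun x => ψ x * p (φ x) := by
    have := hT f
    rwa [muntzFun_eq_of_mem_muntzPolynomials hΛ hmono hsum hp hp1.coeFn_toLp] at this
  have h2 : ‖f‖ₑ = eLpNorm p 1 (volume : Measure I) := Lp.enorm_toLp hp1
  have h3 := setLIntegral_weightedPullback hφ hψ
    (continuous_of_mem_muntzPolynomials hΛ hp).measurable MeasurableSet.univ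
  simp only [preimage_univ, Measure.restrict_univ] at h3
  rw [eLpNorm_one_eq_lintegral_enorm, h3, ← eLpNorm_one_eq_lintegral_enorm,
    ← eLpNorm_congr_ae h1, ← Lp.enorm_def, ← h2]
  refine (T.le_opENorm f).trans ?_
  gcongr
  rw [enorm_eq_nnnorm]
  exact_mod_cast le_self_add

/-! ### Finite rank approximation away from `1` -/

/-- Completeness of `Y` makes `J` a closed embedding, so preimages of compact sets under `J` are
compact. -/
theorem IsCompactOperator.of_linearIsometry_comp {X Y Z : Type*} [NormedAddCommGroup X]
    [NormedSpace 𝕜 X] [NormedAddCommGroup Y] [NormedSpace 𝕜 Y] [CompleteSpace Y]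
    [NormedAddCommGroup Z] [NormedSpace 𝕜 Z] {S : X → Y} (J : Y →ₗᵢ[𝕜] Z)
    (h : IsCompactOperator fun x => J (S x)) : IsCompactOperator S := by
  obtain ⟨K, hK, hK'⟩ := h
  exact ⟨J ⁻¹' K, J.isometry.isClosedEmbedding.isCompact_preimage hK, hK'⟩

theorem isCompactOperator_smulRight {X Y : Type*} [NormedAddCommGroup X] [NormedSpace 𝕜 X]
    [NormedAddCommGroup Y] [NormedSpace 𝕜 Y] (l : X →L[𝕜] 𝕜) (e : Y) :
    IsCompactOperator (l.smulRight e) :=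
  (isCompactOperator_of_locallyCompactSpace_rng
    (ContinuousLinearMap.toSpanSingleton 𝕜 e)).comp_clm l

theorem isCompactOperator_finsetSum {X Y ι : Type*} [NormedAddCommGroup X] [NormedSpace 𝕜 X]
    [NormedAddCommGroup Y] [NormedSpace 𝕜 Y] (s : Finset ι) (F : ι → X →L[𝕜] Y)
    (h : ∀ i ∈ s, IsCompactOperator (F i)) : IsCompactOperator (∑ i ∈ s, F i : X →L[𝕜] Y) := by
  have : (∑ i ∈ s, F i : X →L[𝕜] Y) ∈ compactOperator (RingHom.id 𝕜) X Y :=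
    Submodule.sum_mem _ h
  exact this

/-- Point evaluations are the functionals from which the finite rank approximants are built. -/
theorem exists_muntz_evaluation (𝕜 : Type*) [RCLike 𝕜] (hΛ : ∀ n, 0 < Λ n)
    (hmono : StrictMono Λ) (hsum : Summable fun n => 1 / Λ n) {x : I} (hx : x < 1) :
    ∃ l : muntzSpace 𝕜 Λ →L[𝕜] 𝕜, ∀ f, l f = muntzFun (f : Lp 𝕜 1 (volume : Measure I)) x := by
  have hx1 : (x : ℝ) < 1 := hx
  have hx0 := x.2.1
  obtain ⟨C, hC, h⟩ := exists_muntzFun_bound 𝕜 hΛ hmono hsum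
    (r := ((x : ℝ) + 1) / 2) (by linarith) (by linarith)
  refine ⟨LinearMap.mkContinuous
    { toFun := fun f => muntzFun (f : Lp 𝕜 1 (volume : Measure I)) x
      map_add' := fun f g => muntzFun_add hΛ hmono hsum f.2 g.2 hx
      map_smul' := fun c f => muntzFun_smul hΛ hmono hsum c f.2 hx }
    (C * (x : ℝ) ^ Λ 0) fun f => h f f.2 x (by linarith), fun f => rfl⟩

/-- Replaces finiteness of `μ`, which may fail near `0`. -/
theorem IsMuntzEmbedding.lintegral_rpow_lt_top (hΛ : ∀ n, 0 < Λ n) {μ : Measure I}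
    (h : IsMuntzEmbedding 𝕜 Λ μ) : ∫⁻ x : I, ENNReal.ofReal ((x : ℝ) ^ Λ 0) ∂μ < ∞ := by
  obtain ⟨C, -, hC⟩ := h
  have hp : muntzMonomial 𝕜 (Λ 0) ∈ muntzPolynomials 𝕜 Λ := Submodule.subset_span ⟨0, rfl⟩
  have h1 := hC _ hp
  rw [eLpNorm_one_eq_lintegral_enorm] at h1
  have h2 : ∀ x : I, ‖muntzMonomial 𝕜 (Λ 0) x‖ₑ = ENNReal.ofReal ((x : ℝ) ^ Λ 0) := fun x => by
    rw [muntzMonomial, ← ofReal_norm, RCLike.norm_ofReal,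
      abs_of_nonneg (Real.rpow_nonneg x.2.1 _)]
  simp_rw [h2] at h1
  exact h1.trans_lt (ENNReal.mul_lt_top ENNReal.coe_lt_top
    (memLp_of_mem_muntzPolynomials hΛ hp).2)

/-- The embedding operator is, up to a small error, a finite rank operator plus its restriction to
a neighbourhood of `1`. -/
theorem IsEmbeddingOperator.exists_isCompactOperator_sub_le (hΛ : ∀ n, 0 < Λ n)
    (hmono : StrictMono Λ) (hsum : Summable fun n => 1 / Λ n) {μ : Measure I}
    {S : muntzSpace 𝕜 Λ →L[𝕜] Lp 𝕜 1 μ} (hS : IsEmbeddingOperator μ S)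
    {r : ℝ} (hr : 0 < r) (hr1 : r < 1) {ε : ℝ} (hε : 0 < ε) :
    ∃ U : muntzSpace 𝕜 Λ →L[𝕜] Lp 𝕜 1 μ, IsCompactOperator U ∧ ∀ f : muntzSpace 𝕜 Λ,
      ‖(S - U) f‖ₑ ≤ (∫⁻ x in {x : I | r ≤ (x : ℝ)},
        ‖muntzFun (f : Lp 𝕜 1 (volume : Measure I)) x‖ₑ ∂μ) + ENNReal.ofReal (ε * ‖f‖) := by
  classical
  have hemb := hS.isMuntzEmbedding hΛ hmono hsum
  obtain ⟨β, C, hβ, hC, hhol⟩ := exists_muntzFun_holder_bound 𝕜 hΛ hmono hsum hr hr1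
  obtain ⟨C', hC', hbd⟩ := exists_muntzFun_bound 𝕜 hΛ hmono hsum hr hr1
  set W := ∫⁻ x : I, ENNReal.ofReal ((x : ℝ) ^ Λ 0) ∂μ with hW
  have hWtop : W < ∞ := hemb.lintegral_rpow_lt_top hΛ
  -- An error `C ‖f‖ δ x^λ₀` integrates to at most `ε ‖f‖`; the summand `1` covers `W = 0`.
  set δ := ε / (C * (W.toReal + 1)) with hδ
  have hW0 : 0 ≤ W.toReal := ENNReal.toReal_nonneg
  have hδ0 : 0 < δ := by positivity
  -- Cells are cut by the values of `x ^ β`, so that `|x^β - y^β| ≤ δ` inside a cell and finitely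
  -- many cells suffice.
  set i : I → ℕ := fun x => ⌊(x : ℝ) ^ β / δ⌋₊ with hi
  have him : Measurable i := by
    have : Continuous fun x : I => (x : ℝ) ^ β / δ :=
      ((Real.continuous_rpow_const hβ.le).comp continuous_subtype_val).div_const _
    exact Nat.measurable_floor.comp this.measurable
  set s : ℕ → Set I := fun k => {x : I | 0 < (x : ℝ) ∧ (x : ℝ) < r ∧ i x = k} with hs
  have hsm : ∀ k, MeasurableSet (s k) := fun k =>
    (measurableSet_lt measurable_const measurable_subtype_coe).inter
      ((measurableSet_lt measurable_subtype_coe measurable_const).inter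
        (him (measurableSet_singleton k)))
  have hpick : ∀ k, ∃ c : I, 0 < (c : ℝ) ∧ (c : ℝ) < r ∧ ((s k).Nonempty → i c = k) := by
    intro k
    by_cases h : (s k).Nonempty
    · obtain ⟨c, h1, h2, h3⟩ := h
      exact ⟨c, h1, h2, fun _ => h3⟩
    · exact ⟨⟨r / 2, by constructor <;> linarith⟩, by simpa using hr, by simpa using hr,
        fun h' => absurd h' h⟩
  choose c hc0 hcr hci using hpick
  choose l hl using fun k => exists_muntz_evaluation 𝕜 hΛ hmono hsum
    (show c k < 1 from show (c k : ℝ) < 1 from (hcr k).trans hr1)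
  have hemem : ∀ k, MemLp ((s k).indicator (muntzMonomial 𝕜 (Λ 0))) 1 μ := by
    intro k
    refine MemLp.indicator (hsm k) ⟨(continuous_muntzMonomial (hΛ 0)).aestronglyMeasurable, ?_⟩
    rw [eLpNorm_one_eq_lintegral_enorm]
    refine lt_of_le_of_lt (lintegral_mono fun x => le_of_eq ?_) hWtop
    rw [muntzMonomial, ← ofReal_norm, RCLike.norm_ofReal,
      abs_of_nonneg (Real.rpow_nonneg x.2.1 _)]
  set m := ⌊1 / δ⌋₊ + 1 with hm
  have him' : ∀ x : I, i x < m := by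
    intro x
    refine Nat.lt_succ_of_le (Nat.floor_le_floor ?_)
    gcongr
    exact Real.rpow_le_one x.2.1 x.2.2 hβ.le
  -- On the `k`-th cell, `x^(-λ₀) f` is frozen at its value at the representative `c k` and
  -- multiplied back by `x^λ₀`.
  set U : muntzSpace 𝕜 Λ →L[𝕜] Lp 𝕜 1 μ := ∑ k ∈ Finset.range m,
    ((((c k : ℝ) ^ (-Λ 0) : ℝ) : 𝕜) • l k).smulRight ((hemem k).toLp _) with hU
  have hUf : ∀ f : muntzSpace 𝕜 Λ, (U f : I → 𝕜) =ᵐ[μ] fun x => ∑ k ∈ Finset.range m,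
      ((c k : ℝ) ^ (-Λ 0) • muntzFun (f : Lp 𝕜 1 (volume : Measure I)) (c k)) *
        (s k).indicator (muntzMonomial 𝕜 (Λ 0)) x := by
    intro f
    have e : U f = ∑ k ∈ Finset.range m,
        ((c k : ℝ) ^ (-Λ 0) • muntzFun (f : Lp 𝕜 1 (volume : Measure I)) (c k)) •
          (hemem k).toLp _ := by
      rw [hU, _root_.sum_apply]
      refine Finset.sum_congr rfl fun k _ => ?_
      rw [ContinuousLinearMap.smulRight_apply, _root_.smul_apply, hl,
        RCLike.real_smul_eq_coe_mul, smul_eq_mul]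
    rw [e]
    refine (Lp.coeFn_finsetSum _ _).trans ?_
    have h1 : ∀ k, ((((c k : ℝ) ^ (-Λ 0) •
        muntzFun (f : Lp 𝕜 1 (volume : Measure I)) (c k)) • (hemem k).toLp _ : Lp 𝕜 1 μ) : I → 𝕜)
          =ᵐ[μ] fun x => ((c k : ℝ) ^ (-Λ 0) •
            muntzFun (f : Lp 𝕜 1 (volume : Measure I)) (c k)) *
              (s k).indicator (muntzMonomial 𝕜 (Λ 0)) x := by
      intro k
      refine (Lp.coeFn_smul _ _).trans ?_
      filter_upwards [(hemem k).coeFn_toLp] with x hx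
      rw [Pi.smul_apply, hx, smul_eq_mul]
    filter_upwards [ae_all_iff.2 h1] with x hx
    rw [Finset.sum_apply]
    exact Finset.sum_congr rfl fun k _ => hx k
  refine ⟨U, isCompactOperator_finsetSum _ _ fun k _ => isCompactOperator_smulRight _ _,
    fun f => ?_⟩
  have hpt : ∀ᵐ x ∂μ, ‖(S - U) f x‖ₑ ≤ {x : I | r ≤ (x : ℝ)}.indicator
      (fun x => ‖muntzFun (f : Lp 𝕜 1 (volume : Measure I)) x‖ₑ) x +
        ENNReal.ofReal (C * ‖f‖ * δ) * ENNReal.ofReal ((x : ℝ) ^ Λ 0) := by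
    filter_upwards [Lp.coeFn_sub (S f) (U f), hS f, hUf f] with x h1 h2 h3
    rw [_root_.sub_apply, h1, Pi.sub_apply, h2, h3]
    rcases le_or_gt r (x : ℝ) with hxr | hxr
    · rw [Finset.sum_eq_zero, sub_zero, indicator_of_mem (show x ∈ {x : I | r ≤ (x : ℝ)} from hxr)]
      · exact le_self_add
      · intro k _
        rw [indicator_of_notMem, mul_zero]
        exact fun h => absurd h.2.1 (not_lt.2 hxr)
    rw [indicator_of_notMem (show x ∉ {x : I | r ≤ (x : ℝ)} from not_le.2 hxr), zero_add]
    -- The cells omit `0`, where the bound by `x^λ₀` forces `f` to vanish.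
    rcases (show 0 ≤ (x : ℝ) from x.2.1).eq_or_lt with hx0 | hx0
    · have hz : muntzFun (f : Lp 𝕜 1 (volume : Measure I)) x = 0 := by
        have := hbd f f.2 x hxr.le
        rw [← hx0, Real.zero_rpow (hΛ 0).ne', mul_zero, zero_mul] at this
        exact norm_le_zero_iff.1 this
      rw [Finset.sum_eq_zero, hz, sub_zero, enorm_zero]
      · exact zero_le
      · intro k _
        rw [indicator_of_notMem, mul_zero]
        exact fun h => absurd hx0 h.1.ne
    have hxs : x ∈ s (i x) := ⟨hx0, hxr, rfl⟩
    rw [Finset.sum_eq_single (i x)]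
    · rw [indicator_of_mem hxs, ← ENNReal.ofReal_mul (by positivity), ← ofReal_norm]
      refine ENNReal.ofReal_le_ofReal ?_
      set F := muntzFun (f : Lp 𝕜 1 (volume : Measure I))
      have e1 : F x - ((c (i x) : ℝ) ^ (-Λ 0) • F (c (i x))) * muntzMonomial 𝕜 (Λ 0) x =
          ((x : ℝ) ^ Λ 0) • (((x : ℝ) ^ (-Λ 0)) • F x - (c (i x) : ℝ) ^ (-Λ 0) • F (c (i x))) := by
        rw [smul_sub, smul_smul, ← Real.rpow_add hx0, add_neg_cancel, Real.rpow_zero, one_smul,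
          muntzMonomial, mul_comm _ ((((x : ℝ) ^ Λ 0 : ℝ)) : 𝕜), ← RCLike.real_smul_eq_coe_mul]
      rw [e1, norm_smul, Real.norm_of_nonneg (Real.rpow_nonneg hx0.le _), mul_comm]
      gcongr
      refine (hhol f f.2 x ⟨hx0, hxr.le⟩ (c (i x)) ⟨hc0 _, (hcr _).le⟩).trans ?_
      rw [Submodule.coe_norm]
      gcongr
      have hci' := hci (i x) ⟨x, hxs⟩
      have a1 : ∀ t : I, (i t : ℝ) * δ ≤ (t : ℝ) ^ β ∧ (t : ℝ) ^ β < (i t + 1) * δ := by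
        intro t
        have : 0 ≤ (t : ℝ) ^ β / δ := div_nonneg (Real.rpow_nonneg t.2.1 _) hδ0.le
        exact ⟨(le_div_iff₀ hδ0).1 (Nat.floor_le this),
          (div_lt_iff₀ hδ0).1 (Nat.lt_floor_add_one _)⟩
      have a2 := a1 x
      have a3 := a1 (c (i x))
      rw [hci'] at a3
      exact abs_le.2 ⟨by linarith, by linarith⟩
    · intro k _ hk
      rw [indicator_of_notMem, mul_zero]
      exact fun h => hk h.2.2.symm
    · intro h
      exact absurd (Finset.mem_range.2 (him' x)) h
  have hset : MeasurableSet {x : I | r ≤ (x : ℝ)} :=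
    measurableSet_le measurable_const measurable_subtype_coe
  rw [Lp.enorm_def, eLpNorm_one_eq_lintegral_enorm]
  refine (lintegral_mono_ae hpt).trans ?_
  rw [lintegral_add_left ((measurable_muntzFun hΛ hmono hsum f.2).enorm.indicator hset),
    lintegral_indicator hset, lintegral_const_mul' _ _ ENNReal.ofReal_ne_top, ← hW]
  gcongr
  rw [← ENNReal.ofReal_toReal hWtop.ne, ← ENNReal.ofReal_mul (by positivity)]
  refine ENNReal.ofReal_le_ofReal ?_
  calc C * ‖f‖ * δ * W.toReal ≤ C * ‖f‖ * δ * (W.toReal + 1) := by gcongr; linarith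
    _ = ε * ‖f‖ := by rw [hδ]; field_simp

/-! ### Uniform integrability, essential norms and tails -/

/-- The images of the unit ball under a compact operator into `L¹` are uniformly integrable. -/
theorem IsCompactOperator.eventually_setLIntegral_le {X : Type*} [NormedAddCommGroup X]
    [NormedSpace 𝕜 X] {α : Type*} [MeasurableSpace α] {ν : Measure α} {K : X →L[𝕜] Lp 𝕜 1 ν}
    (hK : IsCompactOperator K) {E : ℕ → Set α} (hE : Tendsto (fun n => ν (E n)) atTop (𝓝 0))
    {ε : ℝ} (hε : 0 < ε) :
    ∀ᶠ n in atTop, ∀ x : X, ∫⁻ t in E n, ‖K x t‖ₑ ∂ν ≤ ENNReal.ofReal (ε * ‖x‖) := by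
  obtain ⟨Q, hQ, hsub⟩ := hK.image_closedBall_subset_compact (f := (K : X →ₗ[𝕜] Lp 𝕜 1 ν)) 1
  obtain ⟨t, -, htfin, ht⟩ := Metric.finite_approx_of_totallyBounded hQ.totallyBounded (ε / 2)
    (half_pos hε)
  -- Each point of the finite `ε/2`-net is integrable, so one index serves them all; the rest of the
  -- image of the ball is within `ε/2` in `L¹`.
  have h1 : ∀ g ∈ t, ∀ᶠ n in atTop, ∫⁻ a in E n, ‖g a‖ₑ ∂ν ≤ ENNReal.ofReal (ε / 2) := by
    intro g _
    have hg : ∫⁻ a, ‖g a‖ₑ ∂ν ≠ ∞ := by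
      rw [← eLpNorm_one_eq_lintegral_enorm]
      exact (Lp.eLpNorm_lt_top g).ne
    exact ((tendsto_setLIntegral_zero hg hE).eventually_lt_const
      (ENNReal.ofReal_pos.2 (half_pos hε))).mono fun n hn => hn.le
  filter_upwards [(eventually_all_finite htfin).2 h1] with n hn
  have hball : ∀ x : X, ‖x‖ ≤ 1 → ∫⁻ a in E n, ‖K x a‖ₑ ∂ν ≤ ENNReal.ofReal ε := by
    intro x hx
    have hxQ : K x ∈ Q := hsub ⟨x, by simpa using hx, rfl⟩
    obtain ⟨g, hg, hgx⟩ := mem_iUnion₂.1 (ht hxQ)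
    have h2 : ∫⁻ a in E n, ‖(K x - g) a‖ₑ ∂ν ≤ ENNReal.ofReal (ε / 2) := by
      refine (setLIntegral_le_lintegral _ _).trans ?_
      rw [← eLpNorm_one_eq_lintegral_enorm, ← Lp.enorm_def, ← ofReal_norm,
        ← dist_eq_norm]
      exact ENNReal.ofReal_le_ofReal (le_of_lt hgx)
    have h3 : ∀ᵐ a ∂(ν.restrict (E n)), ‖K x a‖ₑ ≤ ‖(K x - g) a‖ₑ + ‖g a‖ₑ := by
      refine ae_restrict_of_ae ?_
      filter_upwards [Lp.coeFn_sub (K x) g] with a ha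
      rw [ha, Pi.sub_apply]
      simpa using enorm_add_le (K x a - g a) (g a)
    calc ∫⁻ a in E n, ‖K x a‖ₑ ∂ν ≤ ∫⁻ a in E n, (‖(K x - g) a‖ₑ + ‖g a‖ₑ) ∂ν :=
          lintegral_mono_ae h3
      _ = (∫⁻ a in E n, ‖(K x - g) a‖ₑ ∂ν) + ∫⁻ a in E n, ‖g a‖ₑ ∂ν :=
          lintegral_add_right _ (Lp.stronglyMeasurable g).measurable.enorm
      _ ≤ ENNReal.ofReal (ε / 2) + ENNReal.ofReal (ε / 2) := add_le_add h2 (hn g hg)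
      _ = ENNReal.ofReal ε := by
          rw [← ENNReal.ofReal_add (by positivity) (by positivity), add_halves]
  intro x
  rcases eq_or_ne x 0 with rfl | hx
  · have : ∫⁻ a in E n, ‖K (0 : X) a‖ₑ ∂ν = 0 := by
      rw [map_zero, lintegral_congr_ae (g := fun _ => 0), lintegral_zero]
      refine ae_restrict_of_ae ?_
      filter_upwards [Lp.coeFn_zero 𝕜 1 ν] with a ha
      rw [ha, Pi.zero_apply, enorm_zero]
    rw [this]
    exact zero_le
  · have hx0 : 0 < ‖x‖ := norm_pos_iff.2 hx
    set y : X := ((‖x‖⁻¹ : ℝ) : 𝕜) • x with hy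
    have hy1 : ‖y‖ ≤ 1 := by
      rw [hy, norm_smul, RCLike.norm_ofReal, abs_of_pos (inv_pos.2 hx0), inv_mul_cancel₀ hx0.ne']
    have hxy : x = ((‖x‖ : ℝ) : 𝕜) • y := by
      rw [hy, smul_smul, ← RCLike.ofReal_mul, mul_inv_cancel₀ hx0.ne', RCLike.ofReal_one, one_smul]
    have h4 : ∀ᵐ a ∂(ν.restrict (E n)), ‖K x a‖ₑ = ENNReal.ofReal ‖x‖ * ‖K y a‖ₑ := by
      refine ae_restrict_of_ae ?_
      have : K x = ((‖x‖ : ℝ) : 𝕜) • K y := by rw [← map_smul, ← hxy]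
      filter_upwards [Lp.coeFn_smul ((‖x‖ : ℝ) : 𝕜) (K y)] with a ha
      rw [this, ha, Pi.smul_apply, enorm_smul, ← ofReal_norm, RCLike.norm_ofReal, abs_norm]
    rw [lintegral_congr_ae h4, lintegral_const_mul' _ _ ENNReal.ofReal_ne_top, mul_comm ε,
      ENNReal.ofReal_mul (norm_nonneg _)]
    gcongr
    exact hball y hy1

theorem essentialNorm_le {X Y : Type*} [NormedAddCommGroup X] [NormedSpace 𝕜 X]
    [NormedAddCommGroup Y] [NormedSpace 𝕜 Y] (T : X →L[𝕜] Y) {K : X →L[𝕜] Y}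
    (hK : IsCompactOperator K) : essentialNorm T ≤ ‖T - K‖ :=
  ciInf_le (f := fun K : {K : X →L[𝕜] Y // IsCompactOperator K} => ‖T - K.1‖)
    ⟨0, by rintro _ ⟨K, rfl⟩; exact norm_nonneg _⟩ ⟨K, hK⟩

theorem le_essentialNorm {X Y : Type*} [NormedAddCommGroup X] [NormedSpace 𝕜 X]
    [NormedAddCommGroup Y] [NormedSpace 𝕜 Y] {T : X →L[𝕜] Y} {a : ℝ}
    (h : ∀ K : X →L[𝕜] Y, IsCompactOperator K → a ≤ ‖T - K‖) : a ≤ essentialNorm T := by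
  have : Nonempty {K : X →L[𝕜] Y // IsCompactOperator K} :=
    ⟨⟨0, isCompactOperator_zero⟩⟩
  exact le_ciInf fun K => h K.1 K.2

theorem exists_norm_sub_lt_of_essentialNorm_lt {X Y : Type*} [NormedAddCommGroup X]
    [NormedSpace 𝕜 X] [NormedAddCommGroup Y] [NormedSpace 𝕜 Y] {T : X →L[𝕜] Y} {a : ℝ}
    (h : essentialNorm T < a) : ∃ K : X →L[𝕜] Y, IsCompactOperator K ∧ ‖T - K‖ < a := by
  by_contra! hcon
  exact absurd (le_essentialNorm hcon) (not_le.2 h)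

/-- A compact competitor `K` for `S` yields the competitor `J ∘ K` at the same distance. The reverse
inequality is not formal, since compact operators into `Z` need not take values in the range of `J`;
for the embedding it comes from the tails. -/
theorem essentialNorm_linearIsometry_comp_le {X Y Z : Type*} [NormedAddCommGroup X]
    [NormedSpace 𝕜 X] [NormedAddCommGroup Y] [NormedSpace 𝕜 Y] [NormedAddCommGroup Z]
    [NormedSpace 𝕜 Z] (J : Y →ₗᵢ[𝕜] Z) (S : X →L[𝕜] Y) :
    essentialNorm (J.toContinuousLinearMap.comp S) ≤ essentialNorm S := by
  refine le_essentialNorm fun K hK => ?_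
  refine (essentialNorm_le _ (K := J.toContinuousLinearMap.comp K)
    (hK.clm_comp J.toContinuousLinearMap)).trans ?_
  rw [← ContinuousLinearMap.comp_sub]
  exact le_of_eq (J.norm_toContinuousLinearMap_comp)

theorem IsMuntzEmbedding.mono {μ ν : Measure I} (h : IsMuntzEmbedding 𝕜 Λ μ) (hν : ν ≤ μ) :
    IsMuntzEmbedding 𝕜 Λ ν := by
  obtain ⟨C, hC, h⟩ := h
  exact ⟨C, hC, fun p hp => (eLpNorm_mono_measure p hν).trans (h p hp)⟩

theorem IsEmbeddingOperator.enorm_tailMeasure {μ : Measure I} {n : ℕ}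
    {S : muntzSpace 𝕜 Λ →L[𝕜] Lp 𝕜 1 (tailMeasure μ n)}
    (hS : IsEmbeddingOperator (tailMeasure μ n) S) (f : muntzSpace 𝕜 Λ) :
    ‖S f‖ₑ = ∫⁻ x in {x : I | 1 - 1 / (n : ℝ) ≤ (x : ℝ)},
      ‖muntzFun (f : Lp 𝕜 1 (volume : Measure I)) x‖ₑ ∂μ := by
  rw [Lp.enorm_def, eLpNorm_congr_ae (hS f), eLpNorm_one_eq_lintegral_enorm, tailMeasure]

theorem measurableSet_tail (r : ℝ) : MeasurableSet {x : I | r ≤ (x : ℝ)} :=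
  measurableSet_le measurable_const measurable_subtype_coe

/-- The essential norm of the embedding is at most the norm of any of its tails. -/
theorem IsEmbeddingOperator.essentialNorm_le_norm_tail (hΛ : ∀ n, 0 < Λ n)
    (hmono : StrictMono Λ) (hsum : Summable fun n => 1 / Λ n) {μ : Measure I}
    {S : muntzSpace 𝕜 Λ →L[𝕜] Lp 𝕜 1 μ} (hS : IsEmbeddingOperator μ S) {n : ℕ} (hn : 1 < n)
    {S' : muntzSpace 𝕜 Λ →L[𝕜] Lp 𝕜 1 (tailMeasure μ n)}
    (hS' : IsEmbeddingOperator (tailMeasure μ n) S') : essentialNorm S ≤ ‖S'‖ := by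
  refine le_of_forall_pos_le_add fun ε hε => ?_
  have hn1 : (1 : ℝ) < n := by exact_mod_cast hn
  have hn2 : 1 / (n : ℝ) < 1 := by rw [div_lt_one (by linarith)]; exact hn1
  have hn3 : 0 < 1 / (n : ℝ) := by positivity
  obtain ⟨U, hU, h⟩ := hS.exists_isCompactOperator_sub_le hΛ hmono hsum
    (r := 1 - 1 / (n : ℝ)) (by linarith) (by linarith) hε
  refine (essentialNorm_le S hU).trans ?_
  refine ContinuousLinearMap.opNorm_le_bound _ (by positivity) fun f => ?_
  have h1 := h f
  rw [← hS'.enorm_tailMeasure f, ← ofReal_norm, ← ofReal_norm,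
    ← ENNReal.ofReal_add (norm_nonneg _) (by positivity),
    ENNReal.ofReal_le_ofReal_iff (by positivity)] at h1
  refine h1.trans ?_
  rw [add_mul]
  gcongr
  exact S'.le_opNorm f

theorem tendsto_measure_preimage_tail {φ : I → I} (hφ : Measurable φ)
    (h1 : (volume : Measure I) (φ ⁻¹' {1}) = 0) :
    Tendsto (fun n : ℕ => (volume : Measure I) (φ ⁻¹' {x : I | 1 - 1 / (n : ℝ) ≤ (x : ℝ)}))
      atTop (𝓝 0) := by
  -- At `n = 0` the convention `1 / 0 = 0` makes the set `φ⁻¹ {1}`, so the family decreases only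
  -- from `n = 1` on.
  rw [← tendsto_add_atTop_iff_nat 1, ← h1]
  have heq : φ ⁻¹' {1} = ⋂ n : ℕ, φ ⁻¹' {x : I | 1 - 1 / ((n + 1 : ℕ) : ℝ) ≤ (x : ℝ)} := by
    rw [← preimage_iInter]
    congr 1
    ext x
    simp only [mem_singleton_iff, mem_iInter, mem_ofPred_eq]
    constructor
    · rintro rfl n
      have : 0 ≤ 1 / ((n + 1 : ℕ) : ℝ) := by positivity
      simpa using this
    · intro h
      refine Subtype.ext (le_antisymm x.2.2 ?_)
      have : Tendsto (fun n : ℕ => 1 - 1 / ((n + 1 : ℕ) : ℝ)) atTop (𝓝 (1 - 0)) := by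
        refine tendsto_const_nhds.sub ?_
        simpa using tendsto_one_div_add_atTop_nhds_zero_nat (𝕜 := ℝ)
      rw [sub_zero] at this
      exact le_of_tendsto' this h
  rw [heq]
  refine tendsto_measure_iInter_atTop
    (fun n => (hφ (measurableSet_tail _)).nullMeasurableSet) (fun a b hab x hx => ?_)
    ⟨0, measure_ne_top _ _⟩
  refine le_trans ?_ (show 1 - 1 / ((b + 1 : ℕ) : ℝ) ≤ (φ x : ℝ) from hx)
  have : (a : ℝ) ≤ b := by exact_mod_cast hab
  push_cast
  gcongr

/-- The tails of the embedding are asymptotically dominated by the distance of the weighted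
composition operator to any compact operator. -/
theorem IsWeightedCompOperator.eventually_norm_tail_le (hΛ : ∀ n, 0 < Λ n) (hmono : StrictMono Λ)
    (hsum : Summable fun n => 1 / Λ n) {φ : I → I} (hφ : Measurable φ) {ψ : I → 𝕜}
    (hψ : Measurable ψ) (h1 : (volume : Measure I) (φ ⁻¹' {1}) = 0)
    {T : muntzSpace 𝕜 Λ →L[𝕜] Lp 𝕜 1 (volume : Measure I)} (hT : IsWeightedCompOperator φ ψ T)
    {S' : (n : ℕ) → muntzSpace 𝕜 Λ →L[𝕜] Lp 𝕜 1 (tailMeasure (weightedPullback φ ψ) n)}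
    (hS' : ∀ n, IsEmbeddingOperator (tailMeasure (weightedPullback φ ψ) n) (S' n))
    {K : muntzSpace 𝕜 Λ →L[𝕜] Lp 𝕜 1 (volume : Measure I)} (hK : IsCompactOperator K)
    {ε : ℝ} (hε : 0 < ε) : ∀ᶠ n in atTop, ‖S' n‖ ≤ ‖T - K‖ + ε := by
  -- The norm of `S' n f` is the integral of `|T f|` over the preimage of the tail. There `T f = (T
  -- - K) f + K f`, and uniform integrability makes the second term small.
  filter_upwards [hK.eventually_setLIntegral_le (tendsto_measure_preimage_tail hφ h1) hε] with n hn
  refine ContinuousLinearMap.opNorm_le_bound _ (by positivity) fun f => ?_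
  have hle : ‖S' n f‖ₑ ≤ ‖(T - K) f‖ₑ + ENNReal.ofReal (ε * ‖f‖) := by
    set E := φ ⁻¹' {x : I | 1 - 1 / (n : ℝ) ≤ (x : ℝ)}
    have h2 : ∀ᵐ x ∂((volume : Measure I).restrict E),
        ‖ψ x * muntzFun (f : Lp 𝕜 1 (volume : Measure I)) (φ x)‖ₑ ≤
          ‖(T - K) f x‖ₑ + ‖K f x‖ₑ := by
      refine ae_restrict_of_ae ?_
      filter_upwards [hT f, Lp.coeFn_sub (T f) (K f)] with x hx1 hx2
      rw [← hx1, _root_.sub_apply, hx2, Pi.sub_apply]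
      simpa using enorm_add_le (T f x - K f x) (K f x)
    rw [(hS' n).enorm_tailMeasure f, setLIntegral_weightedPullback hφ hψ
      (measurable_muntzFun hΛ hmono hsum f.2) (measurableSet_tail _)]
    refine (lintegral_mono_ae h2).trans ?_
    rw [lintegral_add_right _ (Lp.stronglyMeasurable (K f)).measurable.enorm]
    refine add_le_add ?_ (hn f)
    rw [Lp.enorm_def, eLpNorm_one_eq_lintegral_enorm]
    exact setLIntegral_le_lintegral _ _
  rw [← ofReal_norm, ← ofReal_norm, ← ENNReal.ofReal_add (norm_nonneg _) (by positivity),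
    ENNReal.ofReal_le_ofReal_iff (by positivity)] at hle
  refine hle.trans ?_
  rw [add_mul]
  gcongr
  exact (T - K).le_opNorm f

theorem isWeightedCompOperator_linearIsometry_comp {φ : I → I} (hφ : Measurable φ) {ψ : I → 𝕜}
    (hψ : Measurable ψ) {J : Lp 𝕜 1 (weightedPullback φ ψ) →ₗᵢ[𝕜] Lp 𝕜 1 (volume : Measure I)}
    (hJ : ∀ g, (J g : I → 𝕜) =ᵐ[volume] fun x => ψ x * g (φ x))
    {S : muntzSpace 𝕜 Λ →L[𝕜] Lp 𝕜 1 (weightedPullback φ ψ)}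
    (hS : IsEmbeddingOperator (weightedPullback φ ψ) S) :
    IsWeightedCompOperator φ ψ (J.toContinuousLinearMap.comp S) := fun f =>
  (hJ (S f)).trans (ae_mul_comp_of_ae_weightedPullback hφ hψ (hS f))

theorem IsWeightedCompOperator.eq {φ : I → I} {ψ : I → 𝕜}
    {T T' : muntzSpace 𝕜 Λ →L[𝕜] Lp 𝕜 1 (volume : Measure I)} (hT : IsWeightedCompOperator φ ψ T)
    (hT' : IsWeightedCompOperator φ ψ T') : T = T' :=
  ContinuousLinearMap.ext fun f => Lp.ext ((hT f).trans (hT' f).symm)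

end Muntz

/-! ### The main theorem -/

theorem mainTheorem12 {𝕜 : Type*} [RCLike 𝕜] (Λ : ℕ → ℝ) (hΛpos : ∀ n, 0 < Λ n)
    (hΛmono : StrictMono Λ) (hΛsum : Summable fun n => 1 / Λ n)
    (φ : I → I) (hφ : Measurable φ) (ψ : I → 𝕜) (hψ : Measurable ψ)
    (μ : Measure I) (hμ : μ = weightedPullback φ ψ) :
    -- (i) boundedness
    (((∃ T : muntzSpace 𝕜 Λ →L[𝕜] Lp 𝕜 1 (volume : Measure I),
        IsWeightedCompOperator φ ψ T) ↔ IsMuntzEmbedding 𝕜 Λ μ) ∧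
      ((∃ T : muntzSpace 𝕜 Λ →L[𝕜] Lp 𝕜 1 (volume : Measure I),
        IsWeightedCompOperator φ ψ T) ↔
        ∃ S : muntzSpace 𝕜 Λ →L[𝕜] Lp 𝕜 1 μ, IsEmbeddingOperator μ S)) ∧
    -- (ii) compactness
    ((∃ T : muntzSpace 𝕜 Λ →L[𝕜] Lp 𝕜 1 (volume : Measure I),
        IsWeightedCompOperator φ ψ T ∧ IsCompactOperator T) ↔
      ∃ S : muntzSpace 𝕜 Λ →L[𝕜] Lp 𝕜 1 μ, IsEmbeddingOperator μ S ∧ IsCompactOperator S) ∧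
    -- (iii) essential norms, when the operators are bounded
    ((volume : Measure I) (φ ⁻¹' {1}) = 0 →
      ∀ T : muntzSpace 𝕜 Λ →L[𝕜] Lp 𝕜 1 (volume : Measure I), IsWeightedCompOperator φ ψ T →
        ∃ (S : muntzSpace 𝕜 Λ →L[𝕜] Lp 𝕜 1 μ)
          (S' : (n : ℕ) → muntzSpace 𝕜 Λ →L[𝕜] Lp 𝕜 1 (tailMeasure μ n)),
          IsEmbeddingOperator μ S ∧ (∀ n, IsEmbeddingOperator (tailMeasure μ n) (S' n)) ∧
          essentialNorm T = essentialNorm S ∧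
          Tendsto (fun n => ‖S' n‖) atTop (𝓝 (essentialNorm S))) := by
  subst hμ
  obtain ⟨J, hJ⟩ := exists_weightedComp_linearIsometry hφ hψ
  have hST : ∀ S : muntzSpace 𝕜 Λ →L[𝕜] Lp 𝕜 1 (weightedPullback φ ψ),
      IsEmbeddingOperator (weightedPullback φ ψ) S →
      IsWeightedCompOperator φ ψ (J.toContinuousLinearMap.comp S) := fun S hS =>
    isWeightedCompOperator_linearIsometry_comp hφ hψ hJ hS
  have hTμ : ∀ T : muntzSpace 𝕜 Λ →L[𝕜] Lp 𝕜 1 (volume : Measure I),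
      IsWeightedCompOperator φ ψ T → IsMuntzEmbedding 𝕜 Λ (weightedPullback φ ψ) :=
    fun T hT => hT.isMuntzEmbedding hΛpos hΛmono hΛsum hφ hψ
  have hTS : ∀ T : muntzSpace 𝕜 Λ →L[𝕜] Lp 𝕜 1 (volume : Measure I),
      IsWeightedCompOperator φ ψ T →
      ∃ S : muntzSpace 𝕜 Λ →L[𝕜] Lp 𝕜 1 (weightedPullback φ ψ),
        IsEmbeddingOperator (weightedPullback φ ψ) S ∧ T = J.toContinuousLinearMap.comp S := by
    intro T hT
    obtain ⟨S, hS⟩ := (hTμ T hT).exists_isEmbeddingOperator hΛpos hΛmono hΛsum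
    exact ⟨S, hS, hT.eq (hST S hS)⟩
  refine ⟨⟨⟨fun ⟨T, hT⟩ => hTμ T hT, fun h => ?_⟩, ⟨fun ⟨T, hT⟩ => ?_, fun ⟨S, hS⟩ =>
    ⟨_, hST S hS⟩⟩⟩, ⟨fun ⟨T, hT, hTc⟩ => ?_, fun ⟨S, hS, hSc⟩ =>
    ⟨_, hST S hS, hSc.clm_comp J.toContinuousLinearMap⟩⟩, fun h1 T hT => ?_⟩
  · obtain ⟨S, hS⟩ := h.exists_isEmbeddingOperator hΛpos hΛmono hΛsum
    exact ⟨_, hST S hS⟩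
  · obtain ⟨S, hS, -⟩ := hTS T hT
    exact ⟨S, hS⟩
  · obtain ⟨S, hS, rfl⟩ := hTS T hT
    exact ⟨S, hS, IsCompactOperator.of_linearIsometry_comp J hTc⟩
  · obtain ⟨S, hS, hTeq⟩ := hTS T hT
    choose S' hS' using fun n => ((hTμ T hT).mono
      (show tailMeasure (weightedPullback φ ψ) n ≤ weightedPullback φ ψ from
        Measure.restrict_le_self)).exists_isEmbeddingOperator hΛpos hΛmono hΛsum
    have hTS' : essentialNorm T ≤ essentialNorm S := by
      rw [hTeq]
      exact essentialNorm_linearIsometry_comp_le J S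
    have hlow : ∀ᶠ n in atTop, essentialNorm S ≤ ‖S' n‖ := by
      filter_upwards [eventually_gt_atTop 1] with n hn
      exact hS.essentialNorm_le_norm_tail hΛpos hΛmono hΛsum hn (hS' n)
    have hup : ∀ a, essentialNorm T < a → ∀ᶠ n in atTop, ‖S' n‖ < a := by
      intro a ha
      obtain ⟨K, hK, hlt⟩ := exists_norm_sub_lt_of_essentialNorm_lt ha
      filter_upwards [hT.eventually_norm_tail_le hΛpos hΛmono hΛsum hφ hψ h1 hS' hK
        (half_pos (sub_pos.2 hlt))] with n hn
      linarith
    -- Any `a` above the essential norm of `T` exceeds the norm of some tail, which in turn bounds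
    -- the essential norm of `S`.
    have hST' : essentialNorm S ≤ essentialNorm T := by
      refine le_of_forall_gt_imp_ge_of_dense fun a ha => ?_
      obtain ⟨n, hn1, hn2⟩ := (hlow.and (hup a ha)).exists
      exact hn1.trans hn2.le
    refine ⟨S, S', hS, hS', le_antisymm hTS' hST', ?_⟩
    rw [tendsto_order]
    exact ⟨fun a ha => hlow.mono fun n hn => ha.trans_le hn,
      fun a ha => hup a (hTS'.trans_lt ha)⟩
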